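/- There is a universal constant $C>0$ such that the following holds for all $n\ge 0$ and $m\ge 1$. Let $\mathcal E$ be an ensemble of $n$-qubit unitaries, i.e. a Borel probability measure $\mu$ on the $n$-qubit unitary group, that is Pauli-invariant: for $U\sim\mu$ and every $P\in\{I,X,Y,Z\}^{\otimes n}$, both $PU$ and $UP$ have law $\mu$. For states $\rho,\sigma$ sample $U\sim\mu$ and, given $U$, independent outcomes $a_1,\dots,a_m$ with $\Pr[a]=\langle a|U\rho U^\dagger|a\rangle$ and $b_1,\dots,b_m$ with $\Pr[b]=\langle b|U\sigma U^\dagger|b\rangle$ $(a,b\in\mathbb Z_2^n)$, and put $\mathbb X_m=\frac1{m^2}\sum_{i,j=1}^m f(a_i,b_j)$, with variance $\mathbb V_{\mathcal E}(\mathbb X_m)$ over $U$ and all the outcomes. Let $f:\mathbb Z_2^n\times\mathbb Z_2^n\to\mathbb R$ be a classical function of $\mathcal E$: for every number of shots, $\mathbb X$ is an unbiased estimator of $\operatorname{tr}[\rho\sigma]$ for all states $\rho,\sigma$, and $f(a,b)=f(a\oplus b,0)$ for all $a,b$. Write $\|f\|_2^2:=\sum_a f(a,0)^2$. 1. If $\rho=\sigma=|\psi\rangle\langle\psi|$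 with $\psi$ a Haar random state, then $\mathbb V_{\mathcal E}(\mathbb X_m)$ is integrable in $\psi$ and $$\mathbb E_\psi \mathbb V_{\mathcal E}(\mathbb X_m)\le C\left(\frac{\|f\|_2^2}{2^n m^2}+\frac{\|f\|_2^2}{4^n m}+\frac{\|f\|_2^2}{8^n}+\frac{f(0,0)^2}{4^n}-1\right).$$ 2. If $\rho=|\psi\rangle\langle\psi|$ and $\sigma=|\phi\rangle\langle\phi|$ with $\psi,\phi$ independent Haar random states, then $\mathbb V_{\mathcal E}(\mathbb X_m)$ is integrable in $(\psi,\phi)$ and $$\mathbb E_{\psi,\phi} \mathbb V_{\mathcal E}(\mathbb X_m)\le C\left(\frac{\|f\|_2^2}{2^n m^2}+\frac{\|f\|_2^2}{4^n m}+\frac{\|f\|_2^2}{8^n}\right).$$ -/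

import Mathlib

open MeasureTheory ProbabilityTheory
open scoped ComplexOrder

noncomputable section

namespace DIPE

/-- Bit strings of length `n`; addition is the bitwise XOR. -/
abbrev Bits (n : ℕ) : Type := Fin n → ZMod 2

/-- The `n`-qubit unitary group, acting on the Hilbert space with computational basis `Bits n`. -/
abbrev UnitaryGrp (n : ℕ) : Type := Matrix.unitaryGroup (Bits n) ℂ

instance instMeasurableSpaceUnitaryGrp (n : ℕ) : MeasurableSpace (UnitaryGrp n) :=
  borel (UnitaryGrp n)

instance instBorelSpaceUnitaryGrp (n : ℕ) : BorelSpace (UnitaryGrp n) := ⟨rfl⟩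

instance instCompactSpaceUnitaryGrp (n : ℕ) : CompactSpace (UnitaryGrp n) := by
  refine isCompact_iff_compactSpace.mp ?_
  have hK : IsCompact (Set.univ.pi fun _ : Bits n => Set.univ.pi fun _ : Bits n =>
      Metric.closedBall (0 : ℂ) 1) :=
    isCompact_univ_pi fun _ => isCompact_univ_pi fun _ => isCompact_closedBall 0 1
  refine IsCompact.of_isClosed_subset (s := (Set.univ.pi fun _ : Bits n =>
    Set.univ.pi fun _ : Bits n => Metric.closedBall (0 : ℂ) 1)) hK ?_ ?_
  · have h : ((Matrix.unitaryGroup (Bits n) ℂ : Submonoid (Matrix (Bits n) (Bits n) ℂ)) :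
        Set (Matrix (Bits n) (Bits n) ℂ)) = {A | A * star A = 1} := by
      ext A
      exact Matrix.mem_unitaryGroup_iff
    rw [h]
    exact isClosed_eq (by fun_prop) continuous_const
  · intro A hA i _ j _
    simpa using entry_norm_bound_of_unitary hA i j

/-! ### Pauli operators and Pauli-invariant ensembles -/

/-- The single-qubit Pauli matrices `I, X, Y, Z`. -/
def pauliMatrix : Fin 4 → Matrix (ZMod 2) (ZMod 2) ℂ :=
  ![!![1, 0; 0, 1], !![0, 1; 1, 0], !![0, -Complex.I; Complex.I, 0], !![1, 0; 0, -1]]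

/-- The tensor product `P_{s 1} ⊗ ⋯ ⊗ P_{s n}` of single-qubit Pauli matrices. -/
def pauliString {n : ℕ} (s : Fin n → Fin 4) : Matrix (Bits n) (Bits n) ℂ :=
  Matrix.of fun a b => ∏ i, pauliMatrix (s i) (a i) (b i)

theorem pauliMatrix_mul_star (k : Fin 4) (x y : ZMod 2) :
    ∑ z, pauliMatrix k x z * star (pauliMatrix k y z) = if x = y then 1 else 0 := by
  have key : ∀ (M : Fin 4 → Matrix (Fin 2) (Fin 2) ℂ),
      M = ![!![1, 0; 0, 1], !![0, 1; 1, 0], !![0, -Complex.I; Complex.I, 0], !![1, 0; 0, -1]] →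
      ∀ x y : Fin 2, ∑ z, M k x z * star (M k y z) = if x = y then 1 else 0 := by
    rintro M rfl x y
    rw [Fin.sum_univ_two]
    fin_cases k <;> fin_cases x <;> fin_cases y <;> simp
  exact key pauliMatrix rfl x y

theorem pauliString_mem {n : ℕ} (s : Fin n → Fin 4) :
    pauliString s ∈ Matrix.unitaryGroup (Bits n) ℂ := by
  rw [Matrix.mem_unitaryGroup_iff]
  ext a b
  have h := Finset.prod_univ_sum (fun _ : Fin n => (Finset.univ : Finset (ZMod 2)))
    (fun i z => pauliMatrix (s i) (a i) z * star (pauliMatrix (s i) (b i) z))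
  rw [Fintype.piFinset_univ] at h
  simp only [Matrix.mul_apply, Matrix.star_apply, pauliString, Matrix.of_apply, star_prod,
    ← Finset.prod_mul_distrib, Matrix.one_apply]
  rw [← h]
  simp only [pauliMatrix_mul_star]
  by_cases hab : a = b
  · simp [hab]
  · obtain ⟨i, hi⟩ := Function.ne_iff.mp hab
    rw [if_neg hab]
    exact Finset.prod_eq_zero (Finset.mem_univ i) (if_neg hi)

/-- The `n`-qubit Pauli operator of the string `s`, as a unitary. -/
def pauliUnitary {n : ℕ} (s : Fin n → Fin 4) : UnitaryGrp n := ⟨pauliString s, pauliString_mem s⟩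

/-- A random unitary with law `μ` is Pauli-invariant if `P U` and `U P` have the same law as `U`
for every Pauli operator `P`. -/
def IsPauliInvariant {n : ℕ} (μ : Measure (UnitaryGrp n)) : Prop :=
  ∀ s : Fin n → Fin 4,
    μ.map (fun U => pauliUnitary s * U) = μ ∧ μ.map (fun U => U * pauliUnitary s) = μ

/-! ### The protocol -/

/-- A quantum state: a positive semidefinite matrix of trace one. -/
def IsState {n : ℕ} (ρ : Matrix (Bits n) (Bits n) ℂ) : Prop := ρ.PosSemidef ∧ ρ.trace = 1

/-- The probability `⟨a| U ρ U† |a⟩` of the outcome `a` when `U ρ U†` is measured in the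
computational basis. -/
def bornProb {n : ℕ} (U : UnitaryGrp n) (ρ : Matrix (Bits n) (Bits n) ℂ) (a : Bits n) : ℝ :=
  (((U : Matrix (Bits n) (Bits n) ℂ) * ρ * (U : Matrix (Bits n) (Bits n) ℂ).conjTranspose) a a).re

/-- The joint law of the random unitary `U ∼ μ` and of the `m` outcomes `a` on `ρ` and the `m`
outcomes `b` on `σ`: conditionally on `U`, all `2 m` outcomes are independent, with the
probabilities `bornProb U ρ` and `bornProb U σ`. -/
def jointLaw {n : ℕ} (μ : Measure (UnitaryGrp n)) (m : ℕ) (ρ σ : Matrix (Bits n) (Bits n) ℂ) :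
    Measure (UnitaryGrp n × ((Fin m → Bits n) × (Fin m → Bits n))) :=
  (μ.prod Measure.count).withDensity fun ω =>
    ENNReal.ofReal ((∏ i, bornProb ω.1 ρ (ω.2.1 i)) * ∏ j, bornProb ω.1 σ (ω.2.2 j))

/-- The random variable `X_m = m⁻² ∑ i j, f (a i) (b j)`. -/
def estimator {n : ℕ} (f : Bits n → Bits n → ℝ) (m : ℕ)
    (ω : UnitaryGrp n × ((Fin m → Bits n) × (Fin m → Bits n))) : ℝ :=
  1 / (m : ℝ) ^ 2 * ∑ i, ∑ j, f (ω.2.1 i) (ω.2.2 j)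

/-- `X_m` is an unbiased estimator of `tr (ρ σ)`, for all states and all numbers of shots. -/
def IsUnbiased {n : ℕ} (μ : Measure (UnitaryGrp n)) (f : Bits n → Bits n → ℝ) : Prop :=
  ∀ m : ℕ, 1 ≤ m → ∀ ρ σ : Matrix (Bits n) (Bits n) ℂ, IsState ρ → IsState σ →
    ((∫ ω, estimator f m ω ∂(jointLaw μ m ρ σ) : ℝ) : ℂ) = (ρ * σ).trace

/-- The variance of `X_m`, over the random unitary and the measurement outcomes. -/
def estimatorVariance {n : ℕ} (μ : Measure (UnitaryGrp n)) (f : Bits n → Bits n → ℝ) (m : ℕ)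
    (ρ σ : Matrix (Bits n) (Bits n) ℂ) : ℝ :=
  variance (estimator f m) (jointLaw μ m ρ σ)

/-! ### Haar random states and average variances -/

/-- The Haar probability measure on the unitary group. -/
def haarUnitary (n : ℕ) : Measure (UnitaryGrp n) := Measure.haarMeasure ⊤

/-- The law of a Haar random state `U |0⟩`, with `U` a Haar random unitary. -/
def haarState (n : ℕ) : Measure (Bits n → ℂ) :=
  (haarUnitary n).map fun U : UnitaryGrp n => Matrix.mulVec (U : Matrix (Bits n) (Bits n) ℂ) (Pi.single 0 1)

/-- The rank-one operator `|ψ⟩⟨ψ|`. -/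
def ketbra {n : ℕ} (ψ : Bits n → ℂ) : Matrix (Bits n) (Bits n) ℂ := Matrix.vecMulVec ψ (star ψ)

/-- The average variance for `ρ = σ = |ψ⟩⟨ψ|` with `ψ` a Haar random state. -/
def averageVariance₁ {n : ℕ} (μ : Measure (UnitaryGrp n)) (f : Bits n → Bits n → ℝ) (m : ℕ) : ℝ :=
  ∫ ψ, estimatorVariance μ f m (ketbra ψ) (ketbra ψ) ∂(haarState n)

/-- The average variance for `ρ = |ψ⟩⟨ψ|` and `σ = |φ⟩⟨φ|` with `ψ`, `φ` independent Haar random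
states. -/
def averageVariance₂ {n : ℕ} (μ : Measure (UnitaryGrp n)) (f : Bits n → Bits n → ℝ) (m : ℕ) : ℝ :=
  ∫ p, estimatorVariance μ f m (ketbra p.1) (ketbra p.2) ∂((haarState n).prod (haarState n))

/-- `‖f‖₂² = ∑ a, f(a, 0)²`. -/
def normSq {n : ℕ} (f : Bits n → Bits n → ℝ) : ℝ := ∑ a, f a 0 ^ 2

end DIPE

end

/-!
The average second moments of `X_m` are computed exactly. Write `D = 2 ^ n` and `N = ‖f‖₂²`.

A Haar random state is invariant under every fixed unitary, so averaging over the state absorbs the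
random measurement basis: the mean of a function of the outcome distributions over `ψ` and `U` is
its mean over `ψ` in the computational basis (`integral_integral_of_invariant`). What remains are
moments of the weights `|ψ a|²`. They satisfy the Pólya urn recursion `haarMoment_add_single`, which
follows from `haarMoment_exchange`: rotating two coordinates infinitesimally does not change the
mean of `(ψ x)^(k+1) (ψ x)*^k (ψ y)^l (ψ y)*^(l+1)`, and in the derivative of this monomial the two
terms that are not products of weights vanish by a change of phase.

Unbiasedness pins down what is needed of `f`. At the maximally mixed state it says that
`∑ a, f (a, 0) = 1`; averaged over equal Haar random pure states it then says that `f (0, 0) = D`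
(`isClassicalKernel`). Hence `D² ≤ N`, and `f (0, 0)² / 4 ^ n - 1 = 0`.

For fixed `U`, the second moment of `X_m` splits into four sums, according to whether the two
samples drawn from `ρ`, and those drawn from `σ`, coincide (`meanSq_eq`). With the moments of order
at most four, the Haar average of each sum is a rational function of `D` and `N`
(`IsClassicalKernel.integral_meanSq_self`,
`IsClassicalKernel.integral_meanSq_prod`). For equal states the fourth-order term is
`1 + O(N / D³)`, and the `1` is cancelled by `(tr ρσ)² = 1`; for independent states no cancellation
is needed, and the variance is bounded by the second moment. All error terms are absorbed by
`D² ≤ N`.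
-/

open MeasureTheory ProbabilityTheory
open scoped ComplexOrder

noncomputable section

namespace DIPE

/-! ### Haar random states -/

instance instSecondCountableTopologyUnitaryGrp (n : ℕ) :
    SecondCountableTopology (UnitaryGrp n) :=
  haveI : SecondCountableTopology (Matrix (Bits n) (Bits n) ℂ) :=
    inferInstanceAs (SecondCountableTopology (Bits n → Bits n → ℂ))
  TopologicalSpace.Subtype.secondCountableTopology
    {A : Matrix (Bits n) (Bits n) ℂ | A ∈ Matrix.unitaryGroup (Bits n) ℂ}

instance instIsProbabilityMeasureHaarUnitary (n : ℕ) : IsProbabilityMeasure (haarUnitary n) :=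
  ⟨by simpa [haarUnitary] using
    Measure.haarMeasure_self (K₀ := (⊤ : TopologicalSpace.PositiveCompacts (UnitaryGrp n)))⟩

instance instIsMulLeftInvariantHaarUnitary (n : ℕ) : (haarUnitary n).IsMulLeftInvariant := by
  unfold haarUnitary; infer_instance

theorem continuous_mulVec_unitary {n : ℕ} :
    Continuous fun x : UnitaryGrp n × (Bits n → ℂ) =>
      (x.1 : Matrix (Bits n) (Bits n) ℂ).mulVec x.2 :=
  (continuous_subtype_val.comp continuous_fst).matrix_mulVec continuous_snd

theorem continuous_unitary_mulVec {n : ℕ} (U : UnitaryGrp n) :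
    Continuous fun ψ : Bits n → ℂ => (U : Matrix (Bits n) (Bits n) ℂ).mulVec ψ :=
  continuous_mulVec_unitary.comp (by fun_prop : Continuous fun ψ : Bits n → ℂ => (U, ψ))

theorem continuous_mulVec_const {n : ℕ} (ψ : Bits n → ℂ) :
    Continuous fun U : UnitaryGrp n => (U : Matrix (Bits n) (Bits n) ℂ).mulVec ψ :=
  continuous_mulVec_unitary.comp (by fun_prop : Continuous fun U : UnitaryGrp n => (U, ψ))

instance instIsProbabilityMeasureHaarState (n : ℕ) : IsProbabilityMeasure (haarState n) :=
  Measure.isProbabilityMeasure_map (continuous_mulVec_const _).measurable.aemeasurable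

/-- The law of a Haar random state is invariant under every fixed unitary. -/
theorem map_mulVec_haarState {n : ℕ} (W : UnitaryGrp n) :
    (haarState n).map (fun ψ => (W : Matrix (Bits n) (Bits n) ℂ).mulVec ψ) = haarState n := by
  have h := map_mul_left_eq_self (haarUnitary n) W
  conv_rhs => rw [haarState, ← h]
  rw [haarState, Measure.map_map (continuous_unitary_mulVec W).measurable
    (continuous_mulVec_const _).measurable,
    Measure.map_map (continuous_mulVec_const _).measurable (measurable_const_mul W)]
  congr 1
  ext1 U
  exact Matrix.mulVec_mulVec _ _ _

theorem integral_mulVec_haarState {n : ℕ} {E : Type*} [NormedAddCommGroup E] [NormedSpace ℝ E]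
    (W : UnitaryGrp n) {F : (Bits n → ℂ) → E} (hF : Continuous F)
    [SecondCountableTopologyEither (Bits n → ℂ) E] :
    ∫ ψ, F ((W : Matrix (Bits n) (Bits n) ℂ).mulVec ψ) ∂haarState n = ∫ ψ, F ψ ∂haarState n := by
  conv_rhs => rw [← map_mulVec_haarState W]
  rw [integral_map (continuous_unitary_mulVec W).measurable.aemeasurable
    hF.aestronglyMeasurable]

/-- The unit sphere of the `n`-qubit Hilbert space. -/
def unitVectors (n : ℕ) : Set (Bits n → ℂ) := {ψ | ∑ a, Complex.normSq (ψ a) = 1}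

theorem sum_normSq_eq_dotProduct {n : ℕ} (ψ : Bits n → ℂ) :
    ((∑ a, Complex.normSq (ψ a) : ℝ) : ℂ) = star ψ ⬝ᵥ ψ := by
  simp [dotProduct, Complex.normSq_eq_conj_mul_self]

theorem sum_normSq_mulVec {n : ℕ} (U : UnitaryGrp n) (ψ : Bits n → ℂ) :
    ∑ a, Complex.normSq ((U : Matrix (Bits n) (Bits n) ℂ).mulVec ψ a)
      = ∑ a, Complex.normSq (ψ a) := by
  have h : (U : Matrix (Bits n) (Bits n) ℂ).conjTranspose * U = 1 := by
    simpa [Matrix.star_eq_conjTranspose] using Matrix.mem_unitaryGroup_iff'.mp U.2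
  apply Complex.ofReal_injective
  rw [sum_normSq_eq_dotProduct, sum_normSq_eq_dotProduct, Matrix.star_mulVec,
    ← Matrix.dotProduct_mulVec, Matrix.mulVec_mulVec, h, Matrix.one_mulVec]

theorem mulVec_mem_unitVectors {n : ℕ} (U : UnitaryGrp n) {ψ : Bits n → ℂ}
    (hψ : ψ ∈ unitVectors n) :
    (U : Matrix (Bits n) (Bits n) ℂ).mulVec ψ ∈ unitVectors n :=
  (sum_normSq_mulVec U ψ).trans hψ

theorem isCompact_unitVectors (n : ℕ) : IsCompact (unitVectors n) := by
  have hcl : IsClosed (unitVectors n) :=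
    isClosed_eq (continuous_finsetSum _ fun a _ =>
      Complex.continuous_normSq.comp (continuous_apply a)) continuous_const
  refine (isCompact_closedBall (0 : Bits n → ℂ) 1).of_isClosed_subset hcl fun ψ hψ => ?_
  rw [mem_closedBall_zero_iff, pi_norm_le_iff_of_nonneg zero_le_one]
  intro a
  have h : Complex.normSq (ψ a) ≤ ∑ b, Complex.normSq (ψ b) :=
    Finset.single_le_sum (f := fun b => Complex.normSq (ψ b))
      (fun b _ => Complex.normSq_nonneg _) (Finset.mem_univ a)
  rw [show ∑ b, Complex.normSq (ψ b) = 1 from hψ, Complex.normSq_eq_norm_sq] at h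
  exact (sq_le_one_iff₀ (norm_nonneg _)).mp h

theorem ae_mem_unitVectors (n : ℕ) : ∀ᵐ ψ ∂haarState n, ψ ∈ unitVectors n := by
  refine (ae_map_iff (continuous_mulVec_const _).measurable.aemeasurable
    (isCompact_unitVectors n).measurableSet).mpr ?_
  refine Filter.Eventually.of_forall fun U => mulVec_mem_unitVectors U ?_
  simp [unitVectors, Pi.single_apply, apply_ite Complex.normSq]

theorem integrable_of_continuous_of_ae_mem {X E : Type*} [TopologicalSpace X] [T2Space X]
    [MeasurableSpace X] [OpensMeasurableSpace X] [NormedAddCommGroup E]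
    {ν : Measure X} [IsFiniteMeasure ν] {K : Set X} (hK : IsCompact K) (hν : ∀ᵐ x ∂ν, x ∈ K)
    [SecondCountableTopologyEither X E] {F : X → E} (hF : Continuous F) : Integrable F ν := by
  have h := hF.continuousOn.integrableOn_compact (μ := ν) hK
  rwa [IntegrableOn, Measure.restrict_eq_self_of_ae_mem hν] at h

theorem integrable_haarState {n : ℕ} {E : Type*} [NormedAddCommGroup E]
    [SecondCountableTopologyEither (Bits n → ℂ) E] {F : (Bits n → ℂ) → E} (hF : Continuous F) :
    Integrable F (haarState n) :=
  integrable_of_continuous_of_ae_mem (isCompact_unitVectors n) (ae_mem_unitVectors n) hF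

/-! ### Moments of the computational-basis distribution of a Haar random state -/

/-- The real rotation by the angle `θ` in the plane of the coordinates `x` and `y`. -/
def planeRotationMatrix {n : ℕ} (x y : Bits n) (θ : ℝ) : Matrix (Bits n) (Bits n) ℂ :=
  1 + ((Real.cos θ : ℂ) - 1) • (Matrix.single x x 1 + Matrix.single y y 1)
    + (Real.sin θ : ℂ) • (Matrix.single x y 1 - Matrix.single y x 1)

theorem planeRotationMatrix_mem {n : ℕ} {x y : Bits n} (hxy : x ≠ y) (θ : ℝ) :
    planeRotationMatrix x y θ ∈ Matrix.unitaryGroup (Bits n) ℂ := by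
  rw [Matrix.mem_unitaryGroup_iff]
  have hs : star (planeRotationMatrix x y θ) = 
      1 + ((Real.cos θ : ℂ) - 1) • (Matrix.single x x 1 + Matrix.single y y 1)
        - (Real.sin θ : ℂ) • (Matrix.single x y 1 - Matrix.single y x 1) := by
    simp [planeRotationMatrix, Matrix.star_eq_conjTranspose, Matrix.conjTranspose_single,
      -Complex.ofReal_cos, -Complex.ofReal_sin,
      Complex.conj_ofReal]
    module
  set P : Matrix (Bits n) (Bits n) ℂ := Matrix.single x x 1 + Matrix.single y y 1 with hP
  set J : Matrix (Bits n) (Bits n) ℂ := Matrix.single x y 1 - Matrix.single y x 1 with hJ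
  have hPP : P * P = P := by
    simp [hP, mul_add, add_mul, Matrix.single_mul_single_of_ne, hxy, hxy.symm]
  have hJJ : J * J = -P := by
    simp [hP, hJ, mul_sub, sub_mul, Matrix.single_mul_single_of_ne, hxy, hxy.symm]
    abel
  have hPJ : P * J = J := by
    simp [hP, hJ, mul_sub, add_mul, Matrix.single_mul_single_of_ne, hxy, hxy.symm]
  have hJP : J * P = J := by
    simp [hP, hJ, sub_mul, mul_add, Matrix.single_mul_single_of_ne, hxy, hxy.symm]
    abel
  rw [hs, planeRotationMatrix, ← hP, ← hJ]
  simp only [add_mul, mul_add, mul_sub, one_mul, mul_one, smul_mul_assoc, mul_smul_comm, hPP, hJJ,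
    hPJ, hJP]
  have hcs : (Real.sin θ : ℂ) ^ 2 = 1 - (Real.cos θ : ℂ) ^ 2 := by
    rw [eq_sub_iff_add_eq]; exact_mod_cast Real.sin_sq_add_cos_sq θ
  generalize (Real.cos θ : ℂ) = c at hcs ⊢
  generalize (Real.sin θ : ℂ) = s at hcs ⊢
  match_scalars <;> first | ring1 | linear_combination hcs

/-- The rotation `planeRotationMatrix` as a unitary. -/
def planeRotation {n : ℕ} {x y : Bits n} (hxy : x ≠ y) (θ : ℝ) : UnitaryGrp n :=
  ⟨planeRotationMatrix x y θ, planeRotationMatrix_mem hxy θ⟩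

theorem planeRotation_mulVec {n : ℕ} {x y : Bits n} (hxy : x ≠ y) (θ : ℝ) (ψ : Bits n → ℂ)
    (a : Bits n) :
    (planeRotation hxy θ : Matrix (Bits n) (Bits n) ℂ).mulVec ψ a =
      if a = x then (Real.cos θ : ℂ) * ψ x + (Real.sin θ : ℂ) * ψ y
      else if a = y then (Real.cos θ : ℂ) * ψ y - (Real.sin θ : ℂ) * ψ x else ψ a := by
  simp only [planeRotation, planeRotationMatrix, Matrix.add_mulVec, Matrix.one_mulVec,
    Matrix.smul_mulVec, Matrix.sub_mulVec, Matrix.single_mulVec, Pi.add_apply, Pi.smul_apply,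
    Pi.sub_apply, smul_eq_mul, Function.update_apply, Pi.zero_apply, one_mul]
  split_ifs with h1 h2 h2
  · exact absurd (h1.symm.trans h2) hxy
  · subst h1; ring
  · subst h2; ring
  · ring

/-- The unitary that multiplies the coordinate `x` by `i`. -/
def quarterPhase {n : ℕ} (x : Bits n) : UnitaryGrp n :=
  ⟨Matrix.diagonal fun a => if a = x then Complex.I else 1, by
    rw [Matrix.mem_unitaryGroup_iff, Matrix.star_eq_conjTranspose, Matrix.diagonal_conjTranspose,
      Matrix.diagonal_mul_diagonal, Matrix.diagonal_eq_one]
    ext a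
    by_cases h : a = x <;> simp [h]⟩

theorem quarterPhase_mulVec {n : ℕ} (x : Bits n) (ψ : Bits n → ℂ) (a : Bits n) :
    (quarterPhase x : Matrix (Bits n) (Bits n) ℂ).mulVec ψ a =
      if a = x then Complex.I * ψ a else ψ a := by
  simp [quarterPhase, Matrix.mulVec_diagonal]

/-- A function that changes sign when one coordinate is multiplied by `i` has Haar mean zero. -/
theorem integral_eq_zero_of_quarterPhase {n : ℕ} {F : (Bits n → ℂ) → ℂ} (hF : Continuous F)
    (x : Bits n)
    (h : ∀ ψ, F ((quarterPhase x : Matrix (Bits n) (Bits n) ℂ).mulVec ψ) = -F ψ) :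
    ∫ ψ, F ψ ∂haarState n = 0 := by
  have h1 := integral_mulVec_haarState (quarterPhase x) hF
  simp only [h, integral_neg] at h1
  exact self_eq_neg.mp h1.symm

/-- Infinitesimal rotation invariance: if `D` is the derivative of `F` along the rotations of the
plane of two coordinates, then `D` has Haar mean zero. -/
theorem integral_eq_zero_of_hasDerivAt {n : ℕ} {x y : Bits n} (hxy : x ≠ y)
    {F D : (Bits n → ℂ) → ℂ} (hF : Continuous F) (hD : Continuous D)
    (h : ∀ ψ θ, HasDerivAt
      (fun t => F ((planeRotation hxy t : Matrix (Bits n) (Bits n) ℂ).mulVec ψ))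
      (D ((planeRotation hxy θ : Matrix (Bits n) (Bits n) ℂ).mulVec ψ)) θ) :
    ∫ ψ, D ψ ∂haarState n = 0 := by
  obtain ⟨K, hK⟩ := (isCompact_unitVectors n).exists_bound_of_continuousOn hD.continuousOn
  have key := (hasDerivAt_integral_of_dominated_loc_of_deriv_le (μ := haarState n) (x₀ := (0 : ℝ))
    (F := fun t ψ => F ((planeRotation hxy t : Matrix (Bits n) (Bits n) ℂ).mulVec ψ))
    (F' := fun t ψ => D ((planeRotation hxy t : Matrix (Bits n) (Bits n) ℂ).mulVec ψ))
    (s := Set.univ) (bound := fun _ => K) Filter.univ_mem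
    (Filter.Eventually.of_forall fun t =>
      (hF.comp (continuous_unitary_mulVec _)).aestronglyMeasurable)
    (integrable_haarState (hF.comp (continuous_unitary_mulVec _)))
    (hD.comp (continuous_unitary_mulVec _)).aestronglyMeasurable
    ((ae_mem_unitVectors n).mono fun ψ hψ t _ => hK _ (mulVec_mem_unitVectors _ hψ))
    (integrable_const K)
    (Filter.Eventually.of_forall fun ψ t _ => h ψ t)).2
  simp only [integral_mulVec_haarState _ hF, integral_mulVec_haarState _ hD] at key
  exact key.unique (hasDerivAt_const _ _)

/-- The probability distribution of a computational-basis measurement on `ψ`. -/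
def weight {n : ℕ} (ψ : Bits n → ℂ) (a : Bits n) : ℝ := Complex.normSq (ψ a)

theorem continuous_weight {n : ℕ} : Continuous (weight : (Bits n → ℂ) → Bits n → ℝ) :=
  continuous_pi fun a => Complex.continuous_normSq.comp (continuous_apply a)

/-- The mixed moment `E ∏ a, |ψ a| ^ (2 α a)` of a Haar random state. -/
def haarMoment {n : ℕ} (α : Bits n → ℕ) : ℝ := ∫ ψ, ∏ a, weight ψ a ^ α a ∂haarState n

theorem continuous_prod_weight_pow {n : ℕ} (α : Bits n → ℕ) (s : Finset (Bits n)) :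
    Continuous fun ψ : Bits n → ℂ => ∏ a ∈ s, weight ψ a ^ α a :=
  continuous_finsetProd _ fun a _ => ((continuous_apply a).comp continuous_weight).pow _

/-- Shifting one power between two coordinates: this is the vanishing mean of the derivative of
`(ψ x)^(k+1) (ψ x)*^k (ψ y)^l (ψ y)*^(l+1)`, times a function of the other coordinates, along the
rotations of the plane of `x` and `y`. -/
theorem haarMoment_exchange {n : ℕ} (α : Bits n → ℕ) (x y : Bits n) :
    (α y + 1) * haarMoment (α + Pi.single x 1) = (α x + 1) * haarMoment (α + Pi.single y 1) := by
  by_cases hxy : x = y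
  · subst hxy; rfl
  have hyx : ¬ y = x := fun h => hxy h.symm
  set k := α x
  set l := α y
  set s : Finset (Bits n) := (Finset.univ.erase x).erase y with hs
  let h : (Bits n → ℂ) → ℂ := fun ψ => ((∏ a ∈ s, weight ψ a ^ α a : ℝ) : ℂ)
  have hs' : ∀ a ∈ s, a ≠ x ∧ a ≠ y := fun a ha => by
    simp only [hs, Finset.mem_erase] at ha; exact ⟨ha.2.1, ha.1⟩
  have hh : ∀ ψ φ : Bits n → ℂ, (∀ a, a ≠ x → a ≠ y → ψ a = φ a) → h ψ = h φ := by
    intro ψ φ H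
    simp only [h]
    congr 1
    exact Finset.prod_congr rfl fun a ha => by
      simp only [weight, H a (hs' a ha).1 (hs' a ha).2]
  have hc : Continuous h := Complex.continuous_ofReal.comp (continuous_prod_weight_pow α s)
  have hprod : ∀ (i j : ℕ) (β : Bits n → ℕ), β x = i → β y = j → (∀ a ∈ s, β a = α a) →
      ∀ ψ : Bits n → ℂ, ((∏ a, weight ψ a ^ β a : ℝ) : ℂ) =
        (ψ x * star (ψ x)) ^ i * (ψ y * star (ψ y)) ^ j * h ψ := by
    intro i j β hi hj hβ ψ
    rw [← Finset.mul_prod_erase _ _ (Finset.mem_univ x),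
      ← Finset.mul_prod_erase _ _ (Finset.mem_erase.mpr ⟨hyx, Finset.mem_univ y⟩), hi, hj,
      Finset.prod_congr rfl fun a ha => by rw [hβ a ha]]
    simp [h, weight, Complex.normSq_eq_conj_mul_self, hs, mul_comm, mul_assoc]
  let G₁ : (Bits n → ℂ) → ℂ := fun ψ =>
    (ψ x * star (ψ x)) ^ (k + 1) * (ψ y * star (ψ y)) ^ l * h ψ
  let G₂ : (Bits n → ℂ) → ℂ := fun ψ =>
    (ψ x * star (ψ x)) ^ k * (ψ y * star (ψ y)) ^ (l + 1) * h ψ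
  let R₁ : (Bits n → ℂ) → ℂ := fun ψ =>
    ψ x ^ (k + 1) * (k * star (ψ x) ^ (k - 1)) * ψ y ^ l * star (ψ y) ^ (l + 2) * h ψ
  let R₂ : (Bits n → ℂ) → ℂ := fun ψ =>
    ψ x ^ (k + 2) * star (ψ x) ^ k * (l * ψ y ^ (l - 1)) * star (ψ y) ^ (l + 1) * h ψ
  -- `F` is the rotated monomial, and its derivative is `(k + 1) G₂ + R₁ - R₂ - (l + 1) G₁`.
  let F : (Bits n → ℂ) → ℂ := fun ψ =>
    ψ x ^ (k + 1) * star (ψ x) ^ k * (ψ y ^ l * star (ψ y) ^ (l + 1)) * h ψ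
  have hG₁ : Continuous G₁ := by fun_prop
  have hG₂ : Continuous G₂ := by fun_prop
  have hR₁ : Continuous R₁ := by fun_prop
  have hR₂ : Continuous R₂ := by fun_prop
  have hF : Continuous F := by fun_prop
  -- The cross terms carry the square of the phase of `ψ x`.
  have hR₁0 : ∫ ψ, R₁ ψ ∂haarState n = 0 := by
    refine integral_eq_zero_of_quarterPhase hR₁ x fun ψ => ?_
    have e := hh ((quarterPhase x : Matrix (Bits n) (Bits n) ℂ).mulVec ψ) ψ fun a ha _ => by
      rw [quarterPhase_mulVec, if_neg ha]
    simp only [R₁, e, quarterPhase_mulVec, if_neg hyx, if_true]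
    rcases Nat.eq_zero_or_pos k with hk | hk
    · simp [hk]
    obtain ⟨j, hj⟩ : ∃ j, k = j + 1 := ⟨k - 1, by omega⟩
    have hI : (Complex.I * star Complex.I) ^ j = 1 := by simp
    rw [hj, Nat.add_sub_cancel, star_mul']
    linear_combination (-(ψ x ^ (j + 1 + 1) * (((j + 1 : ℕ) : ℂ) * star (ψ x) ^ j) * ψ y ^ l *
      star (ψ y) ^ (l + 2) * h ψ)) * hI + (Complex.I * star Complex.I) ^ j *
      (ψ x ^ (j + 1 + 1) * (((j + 1 : ℕ) : ℂ) * star (ψ x) ^ j) * ψ y ^ l *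
      star (ψ y) ^ (l + 2) * h ψ) * Complex.I_sq
  have hR₂0 : ∫ ψ, R₂ ψ ∂haarState n = 0 := by
    refine integral_eq_zero_of_quarterPhase hR₂ x fun ψ => ?_
    have e := hh ((quarterPhase x : Matrix (Bits n) (Bits n) ℂ).mulVec ψ) ψ fun a ha _ => by
      rw [quarterPhase_mulVec, if_neg ha]
    simp only [R₂, e, quarterPhase_mulVec, if_neg hyx, if_true]
    have hI : (Complex.I * star Complex.I) ^ k = 1 := by simp
    rw [star_mul']
    linear_combination (-R₂ ψ) * hI + (Complex.I * star Complex.I) ^ k * R₂ ψ * Complex.I_sq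
  have hD := integral_eq_zero_of_hasDerivAt hxy hF
    (D := fun ψ => (k + 1) * G₂ ψ + R₁ ψ - R₂ ψ - (l + 1) * G₁ ψ) (by fun_prop) (by
      intro ψ θ
      set ψθ := (planeRotation hxy θ : Matrix (Bits n) (Bits n) ℂ).mulVec ψ with hψθ
      have hcos : HasDerivAt (fun t : ℝ => (Real.cos t : ℂ)) (-(Real.sin θ : ℂ)) θ := by
        simpa using (Real.hasDerivAt_cos θ).ofReal_comp
      have hsin : HasDerivAt (fun t : ℝ => (Real.sin t : ℂ)) (Real.cos θ : ℂ) θ :=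
        (Real.hasDerivAt_sin θ).ofReal_comp
      have hx : HasDerivAt
          (fun t => (planeRotation hxy t : Matrix (Bits n) (Bits n) ℂ).mulVec ψ x) (ψθ y) θ := by
        simp only [hψθ, planeRotation_mulVec, if_true, if_neg hyx]
        refine ((hcos.mul_const (ψ x)).add (hsin.mul_const (ψ y))).congr_deriv ?_
        ring
      have hy : HasDerivAt
          (fun t => (planeRotation hxy t : Matrix (Bits n) (Bits n) ℂ).mulVec ψ y) (-ψθ x) θ := by
        simp only [hψθ, planeRotation_mulVec, if_true, if_neg hyx]
        refine ((hcos.mul_const (ψ y)).sub (hsin.mul_const (ψ x))).congr_deriv ?_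
        ring
      have he : ∀ t, h ((planeRotation hxy t : Matrix (Bits n) (Bits n) ℂ).mulVec ψ) = h ψ :=
        fun t => hh _ _ fun a ha hb => by rw [planeRotation_mulVec, if_neg ha, if_neg hb]
      have hx' := hx.star
      have hy' := hy.star
      have := (((hx.pow (k + 1)).mul (hx'.pow k)).mul ((hy.pow l).mul (hy'.pow (l + 1)))).mul_const
        (h ψ)
      simp only [F, he]
      refine this.congr_deriv ?_
      simp only [G₁, G₂, R₁, R₂, hψθ, he]
      simp only [← hψθ, star_neg, Pi.mul_apply, Pi.pow_apply, Nat.add_sub_cancel]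
      push_cast
      ring)
  have i₁ := integrable_haarState hG₁
  have i₂ := integrable_haarState hG₂
  have i₃ := integrable_haarState hR₁
  have i₄ := integrable_haarState hR₂
  have i₅ : Integrable (fun ψ => ((k : ℂ) + 1) * G₂ ψ + R₁ ψ) (haarState n) :=
    (i₂.const_mul _).add i₃
  have i₆ : Integrable (fun ψ => ((k : ℂ) + 1) * G₂ ψ + R₁ ψ - R₂ ψ) (haarState n) := i₅.sub i₄
  rw [integral_sub i₆ (i₁.const_mul _), integral_sub i₅ i₄, integral_add (i₂.const_mul _) i₃,
    integral_const_mul, integral_const_mul, hR₁0, hR₂0] at hD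
  have m₁ : ((haarMoment (α + Pi.single x 1) : ℝ) : ℂ) = ∫ ψ, G₁ ψ ∂haarState n := by
    rw [haarMoment, ← integral_complex_ofReal]
    refine integral_congr_ae (Filter.Eventually.of_forall fun ψ => ?_)
    refine hprod (k + 1) l _ (by simp [k]) (by simp [l, hyx]) (fun a ha => ?_) ψ
    simp [(hs' a ha).1]
  have m₂ : ((haarMoment (α + Pi.single y 1) : ℝ) : ℂ) = ∫ ψ, G₂ ψ ∂haarState n := by
    rw [haarMoment, ← integral_complex_ofReal]
    refine integral_congr_ae (Filter.Eventually.of_forall fun ψ => ?_)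
    refine hprod k (l + 1) _ (by simp [k, hxy]) (by simp [l]) (fun a ha => ?_) ψ
    simp [(hs' a ha).2]
  rw [← m₁, ← m₂] at hD
  have : (((l + 1) * haarMoment (α + Pi.single x 1) : ℝ) : ℂ) =
      ((k + 1) * haarMoment (α + Pi.single y 1) : ℝ) := by
    push_cast
    linear_combination -hD
  exact_mod_cast this

theorem prod_weight_pow_add_single {n : ℕ} (α : Bits n → ℕ) (x : Bits n) (ψ : Bits n → ℂ) :
    ∏ a, weight ψ a ^ (α + Pi.single x 1 : Bits n → ℕ) a =
      (∏ a, weight ψ a ^ α a) * weight ψ x := by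
  simp only [Pi.add_apply, pow_add, Finset.prod_mul_distrib]
  simp [Pi.single_apply, pow_ite]

/-- The Pólya urn recursion for the moments of a Haar random state: they are those of the
uniform distribution on the simplex. -/
theorem haarMoment_add_single {n : ℕ} (α : Bits n → ℕ) (y : Bits n) :
    (2 ^ n + ∑ a, (α a : ℝ)) * haarMoment (α + Pi.single y 1) = (α y + 1) * haarMoment α := by
  have hsum : ∑ x, haarMoment (α + Pi.single x 1) = haarMoment α := by
    simp only [haarMoment]
    rw [← integral_finsetSum _ fun x _ => integrable_haarState (continuous_prod_weight_pow _ _)]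
    refine integral_congr_ae ((ae_mem_unitVectors n).mono fun ψ hψ => ?_)
    simp only [prod_weight_pow_add_single]
    rw [← Finset.mul_sum, show ∑ x, weight ψ x = 1 from hψ, mul_one]
  rw [← hsum, Finset.mul_sum, Finset.sum_congr rfl fun x _ => haarMoment_exchange α x y,
    ← Finset.sum_mul, Finset.sum_add_distrib]
  simp [add_comm]

/-! ### The law of the measurement outcomes -/

theorem continuous_bornProb {n : ℕ} (ρ : Matrix (Bits n) (Bits n) ℂ) (a : Bits n) :
    Continuous fun U : UnitaryGrp n => bornProb U ρ a := by
  have h : Continuous fun U : UnitaryGrp n => (U : Matrix (Bits n) (Bits n) ℂ) :=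
    continuous_subtype_val
  exact Complex.continuous_re.comp
    ((((h.matrix_mul continuous_const).matrix_mul h.matrix_conjTranspose)).matrix_elem a a)

theorem bornProb_nonneg {n : ℕ} {ρ : Matrix (Bits n) (Bits n) ℂ} (hρ : IsState ρ)
    (U : UnitaryGrp n) (a : Bits n) : 0 ≤ bornProb U ρ a :=
  (Complex.le_def.mp ((hρ.1.mul_mul_conjTranspose_same
    (U : Matrix (Bits n) (Bits n) ℂ)).diag_nonneg (i := a))).1

theorem sum_bornProb {n : ℕ} {ρ : Matrix (Bits n) (Bits n) ℂ} (hρ : IsState ρ)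
    (U : UnitaryGrp n) : ∑ a, bornProb U ρ a = 1 := by
  have h : (U : Matrix (Bits n) (Bits n) ℂ).conjTranspose * U = 1 := by
    simpa [Matrix.star_eq_conjTranspose] using Matrix.mem_unitaryGroup_iff'.mp U.2
  have e : ((U : Matrix (Bits n) (Bits n) ℂ) * ρ *
      (U : Matrix (Bits n) (Bits n) ℂ).conjTranspose).trace = 1 := by
    rw [Matrix.trace_mul_comm, ← mul_assoc, h, one_mul, hρ.2]
  have := congrArg Complex.re e
  simpa [Matrix.trace, bornProb] using this

theorem sum_prod_eq_one {ι κ : Type*} [Fintype ι] [DecidableEq ι] [Fintype κ] {p : κ → ℝ}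
    (hp : ∑ x, p x = 1) : ∑ a : ι → κ, ∏ i, p (a i) = 1 := by
  have h := Finset.prod_univ_sum (fun _ : ι => (Finset.univ : Finset κ)) (fun _ z => p z)
  rw [Fintype.piFinset_univ] at h
  rw [← h]
  simp [hp]

/-- The joint distribution of two of the samples of an independent family. -/
theorem sum_prod_mul_indicator {ι κ : Type*} [Fintype ι] [DecidableEq ι] [Fintype κ]
    [DecidableEq κ] {p : κ → ℝ} (hp : ∑ x, p x = 1) (i k : ι) (x y : κ) :
    ∑ a : ι → κ, (∏ l, p (a l)) * ((if a i = x then 1 else 0) * (if a k = y then 1 else 0)) =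
      if i = k then (if x = y then p x else 0) else p x * p y := by
  have h := Finset.prod_univ_sum (fun _ : ι => (Finset.univ : Finset κ))
    (fun l z => p z * ((if l = i then (if z = x then 1 else 0) else 1) *
      (if l = k then (if z = y then 1 else 0) else 1)))
  rw [Fintype.piFinset_univ] at h
  have e : ∀ a : ι → κ,
      (∏ l, p (a l)) * ((if a i = x then 1 else 0) * (if a k = y then 1 else 0)) =
      ∏ l, p (a l) * ((if l = i then (if a l = x then 1 else 0) else 1) *
      (if l = k then (if a l = y then 1 else 0) else 1)) := by
    intro a
    simp only [Finset.prod_mul_distrib]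
    simp
  rw [Finset.sum_congr rfl fun a _ => e a, ← h]
  split_ifs with hik hxy
  · subst hik hxy
    rw [Finset.prod_eq_single i (fun b _ hb => by simp [hb, hp]) (by simp)]
    simp
  · subst hik
    refine Finset.prod_eq_zero (Finset.mem_univ i) (Finset.sum_eq_zero fun z _ => ?_)
    by_cases hz : z = x
    · subst hz; simp [hxy]
    · simp [hz]
  · rw [Finset.prod_eq_mul i k hik (fun b _ hb => by simp [hb.1, hb.2, hp]) (by simp) (by simp)]
    simp [hik, Ne.symm hik]

/-- The number of samples equal to `x`. -/
def sampleCount {κ : Type*} [DecidableEq κ] {m : ℕ} (a : Fin m → κ) (x : κ) : ℝ :=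
  ∑ i, if a i = x then 1 else 0

/-- The second moment `E [N x * N y]` of the counts of `m` independent samples from `p`. -/
def pairMoment {κ : Type*} [DecidableEq κ] (m : ℕ) (p : κ → ℝ) (x y : κ) : ℝ :=
  m * (if x = y then p x else 0) + m * (m - 1) * (p x * p y)

theorem sum_prod_mul_sampleCount {κ : Type*} [Fintype κ] [DecidableEq κ] {p : κ → ℝ}
    (hp : ∑ x, p x = 1) (m : ℕ) (x : κ) :
    ∑ a : Fin m → κ, (∏ i, p (a i)) * sampleCount a x = m * p x := by
  simp only [sampleCount, Finset.mul_sum]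
  rw [Finset.sum_comm]
  have h : ∀ i : Fin m, ∑ a : Fin m → κ, (∏ l, p (a l)) * (if a i = x then 1 else 0) = p x := by
    intro i
    refine Eq.trans (Finset.sum_congr rfl fun a _ => ?_)
      ((sum_prod_mul_indicator hp i i x x).trans (by simp))
    split_ifs <;> simp
  simp only [h]
  simp

theorem sum_prod_mul_sampleCount_mul {κ : Type*} [Fintype κ] [DecidableEq κ] {p : κ → ℝ}
    (hp : ∑ x, p x = 1) (m : ℕ) (x y : κ) :
    ∑ a : Fin m → κ, (∏ i, p (a i)) * (sampleCount a x * sampleCount a y) =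
      pairMoment m p x y := by
  simp only [sampleCount, Finset.sum_mul_sum]
  simp only [Finset.mul_sum]
  rw [Finset.sum_comm]
  simp_rw [Finset.sum_comm (s := (Finset.univ : Finset (Fin m → κ)))]
  simp only [sum_prod_mul_indicator hp]
  have h : ∀ i j : Fin m, (if i = j then (if x = y then p x else 0) else p x * p y) =
      p x * p y + if i = j then (if x = y then p x else 0) - p x * p y else 0 := by
    intro i j; split_ifs <;> ring
  simp only [h, Finset.sum_add_distrib, Finset.sum_const, Finset.card_univ, Fintype.card_fin,
    nsmul_eq_mul, Finset.sum_ite_eq, Finset.mem_univ, if_true, pairMoment]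
  ring

theorem sum_comp_eq_sum_sampleCount {κ : Type*} [Fintype κ] [DecidableEq κ] (g : κ → ℝ) {m : ℕ}
    (a : Fin m → κ) : ∑ i, g (a i) = ∑ x, g x * sampleCount a x := by
  simp only [sampleCount, Finset.mul_sum]
  rw [Finset.sum_comm]
  simp

theorem sum_eq_sum_sampleCount {κ : Type*} [Fintype κ] [DecidableEq κ] (f : κ → κ → ℝ) {m : ℕ}
    (a b : Fin m → κ) :
    ∑ i, ∑ j, f (a i) (b j) = ∑ x, ∑ z, f x z * (sampleCount a x * sampleCount b z) := by
  rw [sum_comp_eq_sum_sampleCount (fun x => ∑ j, f x (b j)) a]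
  refine Finset.sum_congr rfl fun x _ => ?_
  rw [sum_comp_eq_sum_sampleCount (f x) b, Finset.sum_mul]
  exact Finset.sum_congr rfl fun z _ => by ring

/-- The second moment of `X_m` when the outcomes have the distributions `p` and `q`. -/
def meanSq {n : ℕ} (f : Bits n → Bits n → ℝ) (m : ℕ) (p q : Bits n → ℝ) : ℝ :=
  (1 / (m : ℝ) ^ 2) ^ 2 * ∑ x, ∑ z, ∑ y, ∑ w,
    f x z * f y w * (pairMoment m p x y * pairMoment m q z w)

theorem sum_sum_prod_mul {κ : Type*} [Fintype κ] {m : ℕ} (p q : κ → ℝ)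
    (u v : (Fin m → κ) → ℝ) (A B : ℝ) (hA : ∑ a, (∏ i, p (a i)) * u a = A)
    (hB : ∑ b, (∏ i, q (b i)) * v b = B) :
    ∑ o : (Fin m → κ) × (Fin m → κ), (∏ i, p (o.1 i)) * (∏ j, q (o.2 j)) * (u o.1 * v o.2) =
      A * B := by
  rw [← hA, ← hB, Finset.sum_mul_sum, Fintype.sum_prod_type]
  exact Finset.sum_congr rfl fun a _ => Finset.sum_congr rfl fun b _ => by ring

theorem sum_outcomes_estimator {n m : ℕ} (f : Bits n → Bits n → ℝ) (U : UnitaryGrp n)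
    {p q : Bits n → ℝ} (hp : ∑ x, p x = 1) (hq : ∑ x, q x = 1) :
    ∑ o : (Fin m → Bits n) × (Fin m → Bits n), (∏ i, p (o.1 i)) * (∏ j, q (o.2 j)) *
      estimator f m (U, o) = 1 / (m : ℝ) ^ 2 * ∑ x, ∑ z, f x z * (m * p x * (m * q z)) := by
  have h := fun x z => sum_sum_prod_mul (m := m) p q (fun a => sampleCount a x)
    (fun b => sampleCount b z) _ _ (sum_prod_mul_sampleCount hp m x)
    (sum_prod_mul_sampleCount hq m z)
  simp only [estimator, sum_eq_sum_sampleCount, ← h, Finset.mul_sum]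
  rw [Finset.sum_comm]
  refine Finset.sum_congr rfl fun x _ => ?_
  rw [Finset.sum_comm]
  exact Finset.sum_congr rfl fun z _ => Finset.sum_congr rfl fun o _ => by ring

theorem sum_outcomes_estimator_sq {n m : ℕ} (f : Bits n → Bits n → ℝ) (U : UnitaryGrp n)
    {p q : Bits n → ℝ} (hp : ∑ x, p x = 1) (hq : ∑ x, q x = 1) :
    ∑ o : (Fin m → Bits n) × (Fin m → Bits n), (∏ i, p (o.1 i)) * (∏ j, q (o.2 j)) *
      estimator f m (U, o) ^ 2 = meanSq f m p q := by
  have h := fun x z y w => sum_sum_prod_mul (m := m) p q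
    (fun a => sampleCount a x * sampleCount a y)
    (fun b => sampleCount b z * sampleCount b w) _ _ (sum_prod_mul_sampleCount_mul hp m x y)
    (sum_prod_mul_sampleCount_mul hq m z w)
  simp only [estimator, sum_eq_sum_sampleCount, meanSq, ← h, mul_pow]
  simp only [sq (∑ x, ∑ z, _), Finset.sum_mul, Finset.mul_sum]
  rw [Finset.sum_comm]
  refine Finset.sum_congr rfl fun x _ => ?_
  rw [Finset.sum_comm]
  refine Finset.sum_congr rfl fun z _ => ?_
  rw [Finset.sum_comm]
  refine Finset.sum_congr rfl fun y _ => ?_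
  rw [Finset.sum_comm]
  exact Finset.sum_congr rfl fun w _ => Finset.sum_congr rfl fun o _ => by ring

theorem measurable_outcomeDensity {n m : ℕ} (ρ σ : Matrix (Bits n) (Bits n) ℂ) :
    Measurable fun ω : UnitaryGrp n × ((Fin m → Bits n) × (Fin m → Bits n)) =>
      ENNReal.ofReal ((∏ i, bornProb ω.1 ρ (ω.2.1 i)) * ∏ j, bornProb ω.1 σ (ω.2.2 j)) := by
  refine ENNReal.measurable_ofReal.comp (measurable_from_prod_countable_left fun o => ?_)
  have h : Continuous fun U : UnitaryGrp n =>
      (∏ i, bornProb U ρ (o.1 i)) * ∏ j, bornProb U σ (o.2 j) :=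
    (continuous_finsetProd _ fun i _ => continuous_bornProb ρ _).mul
      (continuous_finsetProd _ fun j _ => continuous_bornProb σ _)
  exact h.measurable

theorem outcomeDensity_nonneg {n m : ℕ} {ρ σ : Matrix (Bits n) (Bits n) ℂ} (hρ : IsState ρ)
    (hσ : IsState σ) (U : UnitaryGrp n) (o : (Fin m → Bits n) × (Fin m → Bits n)) :
    0 ≤ (∏ i, bornProb U ρ (o.1 i)) * ∏ j, bornProb U σ (o.2 j) :=
  mul_nonneg (Finset.prod_nonneg fun _ _ => bornProb_nonneg hρ U _)
    (Finset.prod_nonneg fun _ _ => bornProb_nonneg hσ U _)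

theorem isProbabilityMeasure_jointLaw {n : ℕ} (μ : Measure (UnitaryGrp n))
    [IsProbabilityMeasure μ] (m : ℕ) {ρ σ : Matrix (Bits n) (Bits n) ℂ} (hρ : IsState ρ)
    (hσ : IsState σ) : IsProbabilityMeasure (jointLaw μ m ρ σ) := by
  refine ⟨?_⟩
  rw [jointLaw, withDensity_apply _ MeasurableSet.univ, Measure.restrict_univ,
    lintegral_prod _ (measurable_outcomeDensity ρ σ).aemeasurable]
  have h : ∀ U : UnitaryGrp n, ∫⁻ o : (Fin m → Bits n) × (Fin m → Bits n),
      ENNReal.ofReal ((∏ i, bornProb U ρ (o.1 i)) * ∏ j, bornProb U σ (o.2 j))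
        ∂Measure.count = 1 := by
    intro U
    rw [lintegral_count, tsum_fintype,
      ← ENNReal.ofReal_sum_of_nonneg fun o _ => outcomeDensity_nonneg hρ hσ U o]
    have := sum_sum_prod_mul (m := m) (bornProb U ρ) (bornProb U σ) (fun _ => 1) (fun _ => 1) 1 1
      (by simpa using sum_prod_eq_one (sum_bornProb hρ U))
      (by simpa using sum_prod_eq_one (sum_bornProb hσ U))
    simp only [mul_one] at this
    rw [this, ENNReal.ofReal_one]
  simp [h]

theorem memLp_jointLaw {n : ℕ} (μ : Measure (UnitaryGrp n))
    [IsProbabilityMeasure μ] (m : ℕ) {ρ σ : Matrix (Bits n) (Bits n) ℂ} (hρ : IsState ρ)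
    (hσ : IsState σ) (Φ : (Fin m → Bits n) × (Fin m → Bits n) → ℝ) (p : ENNReal) :
    MemLp (fun ω => Φ ω.2) p (jointLaw μ m ρ σ) := by
  have := isProbabilityMeasure_jointLaw μ m hρ hσ
  have h1 : AEStronglyMeasurable (fun ω : UnitaryGrp n × ((Fin m → Bits n) × (Fin m → Bits n)) =>
      Φ ω.2) (jointLaw μ m ρ σ) :=
    ((measurable_of_countable Φ).comp measurable_snd).aestronglyMeasurable
  exact MemLp.of_bound h1 (∑ o, ‖Φ o‖) (Filter.Eventually.of_forall fun ω =>
      Finset.single_le_sum (f := fun o => ‖Φ o‖) (fun _ _ => norm_nonneg _) (Finset.mem_univ ω.2))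

theorem integral_jointLaw {n : ℕ} (μ : Measure (UnitaryGrp n))
    [IsProbabilityMeasure μ] (m : ℕ) {ρ σ : Matrix (Bits n) (Bits n) ℂ} (hρ : IsState ρ)
    (hσ : IsState σ) (Φ : (Fin m → Bits n) × (Fin m → Bits n) → ℝ) :
    ∫ ω, Φ ω.2 ∂jointLaw μ m ρ σ = ∫ U, ∑ o : (Fin m → Bits n) × (Fin m → Bits n),
      (∏ i, bornProb U ρ (o.1 i)) * (∏ j, bornProb U σ (o.2 j)) * Φ o ∂μ := by
  have hi := memLp_one_iff_integrable.mp (memLp_jointLaw μ m hρ hσ Φ 1)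
  rw [jointLaw, integrable_withDensity_iff_integrable_smul' (measurable_outcomeDensity ρ σ)
    (Filter.Eventually.of_forall fun _ => ENNReal.ofReal_lt_top)] at hi
  rw [jointLaw, integral_withDensity_eq_integral_toReal_smul (measurable_outcomeDensity ρ σ)
    (Filter.Eventually.of_forall fun _ => ENNReal.ofReal_lt_top), integral_prod _ hi]
  refine integral_congr_ae (Filter.Eventually.of_forall fun U => ?_)
  simp only [integral_count, smul_eq_mul]
  exact Finset.sum_congr rfl fun o _ => by
    rw [ENNReal.toReal_ofReal (outcomeDensity_nonneg hρ hσ U o)]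

/-- Unbiasedness for a single shot. -/
theorem IsUnbiased.integral_sum {n : ℕ} {μ : Measure (UnitaryGrp n)} [IsProbabilityMeasure μ]
    {f : Bits n → Bits n → ℝ} (hf : IsUnbiased μ f) {ρ σ : Matrix (Bits n) (Bits n) ℂ}
    (hρ : IsState ρ) (hσ : IsState σ) :
    ∫ U, ∑ x, ∑ z, f x z * (bornProb U ρ x * bornProb U σ z) ∂μ = (ρ * σ).trace.re := by
  rw [← hf 1 le_rfl ρ σ hρ hσ, Complex.ofReal_re]
  refine Eq.symm ((integral_jointLaw μ 1 hρ hσ (fun o => estimator f 1 (1, o))).trans ?_)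
  simp only [sum_outcomes_estimator f 1 (sum_bornProb hρ _) (sum_bornProb hσ _)]
  simp

theorem IsUnbiased.estimatorVariance_eq {n : ℕ} {μ : Measure (UnitaryGrp n)}
    [IsProbabilityMeasure μ] {f : Bits n → Bits n → ℝ} (hf : IsUnbiased μ f) {m : ℕ}
    (hm : 1 ≤ m) {ρ σ : Matrix (Bits n) (Bits n) ℂ} (hρ : IsState ρ) (hσ : IsState σ) :
    estimatorVariance μ f m ρ σ =
      ∫ U, meanSq f m (bornProb U ρ) (bornProb U σ) ∂μ - (ρ * σ).trace.re ^ 2 := by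
  have := isProbabilityMeasure_jointLaw μ m hρ hσ
  have hL : MemLp (estimator f m) 2 (jointLaw μ m ρ σ) :=
    memLp_jointLaw μ m hρ hσ (fun o => estimator f m (1, o)) 2
  have h2 : ∫ ω, estimator f m ω ^ 2 ∂jointLaw μ m ρ σ =
      ∫ U, meanSq f m (bornProb U ρ) (bornProb U σ) ∂μ := by
    refine (integral_jointLaw μ m hρ hσ (fun o => estimator f m (1, o) ^ 2)).trans ?_
    simp only [sum_outcomes_estimator_sq f 1 (sum_bornProb hρ _) (sum_bornProb hσ _)]
  rw [estimatorVariance, variance_eq_sub hL, ← hf m hm ρ σ hρ hσ, Complex.ofReal_re, ← h2]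
  rfl

/-! ### Averaging over Haar random states -/

theorem mul_ketbra_mul_conjTranspose {n : ℕ} (A : Matrix (Bits n) (Bits n) ℂ) (ψ : Bits n → ℂ) :
    A * ketbra ψ * A.conjTranspose = ketbra (A.mulVec ψ) := by
  rw [ketbra, ketbra, Matrix.mul_vecMulVec, Matrix.vecMulVec_mul, Matrix.star_mulVec]

theorem bornProb_ketbra {n : ℕ} (U : UnitaryGrp n) (ψ : Bits n → ℂ) :
    bornProb U (ketbra ψ) = weight ((U : Matrix (Bits n) (Bits n) ℂ).mulVec ψ) := by
  ext a
  rw [bornProb, mul_ketbra_mul_conjTranspose, ketbra, weight, Matrix.vecMulVec_apply,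
    Pi.star_apply, ← starRingEnd_apply, Complex.mul_conj, Complex.ofReal_re]

theorem isState_ketbra {n : ℕ} {ψ : Bits n → ℂ} (hψ : ψ ∈ unitVectors n) : IsState (ketbra ψ) := by
  refine ⟨Matrix.posSemidef_vecMulVec_self_star ψ, ?_⟩
  rw [ketbra, Matrix.trace_vecMulVec, dotProduct_comm, ← sum_normSq_eq_dotProduct]
  exact_mod_cast congrArg Complex.ofReal (hψ : ∑ a, Complex.normSq (ψ a) = 1)

theorem trace_ketbra_mul_self {n : ℕ} {ψ : Bits n → ℂ} (hψ : ψ ∈ unitVectors n) :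
    (ketbra ψ * ketbra ψ).trace.re = 1 := by
  have h : star ψ ⬝ᵥ ψ = 1 := by
    rw [← sum_normSq_eq_dotProduct]
    exact_mod_cast congrArg Complex.ofReal (hψ : ∑ a, Complex.normSq (ψ a) = 1)
  have h2 : ketbra ψ * ketbra ψ = ketbra ψ := by
    rw [ketbra, Matrix.vecMulVec_mul_vecMulVec, h, one_smul]
  rw [h2, (isState_ketbra hψ).2, Complex.one_re]

theorem continuous_ketbra {n : ℕ} : Continuous (ketbra : (Bits n → ℂ) → _) :=
  continuous_id.matrix_vecMulVec continuous_star

theorem continuous_trace_ketbra_mul {n : ℕ} :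
    Continuous fun p : (Bits n → ℂ) × (Bits n → ℂ) =>
      (ketbra p.1 * ketbra p.2).trace.re ^ 2 :=
  (Complex.continuous_re.comp (((continuous_ketbra.comp continuous_fst).matrix_mul
    (continuous_ketbra.comp continuous_snd)).matrix_trace)).pow 2

section Product

variable {n : ℕ}

theorem isCompact_unitVectors_prod (n : ℕ) : IsCompact (unitVectors n ×ˢ unitVectors n) :=
  (isCompact_unitVectors n).prod (isCompact_unitVectors n)

theorem ae_mem_unitVectors_prod (n : ℕ) :
    ∀ᵐ p ∂(haarState n).prod (haarState n), p ∈ unitVectors n ×ˢ unitVectors n :=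
  (Measure.ae_prod_mem_iff_ae_ae_mem (isCompact_unitVectors_prod n).measurableSet).mpr
    ((ae_mem_unitVectors n).mono fun _ h1 => (ae_mem_unitVectors n).mono fun _ h2 => ⟨h1, h2⟩)

theorem integrable_haarState_prod {F : (Bits n → ℂ) × (Bits n → ℂ) → ℝ} (hF : Continuous F) :
    Integrable F ((haarState n).prod (haarState n)) :=
  integrable_of_continuous_of_ae_mem (isCompact_unitVectors_prod n) (ae_mem_unitVectors_prod n) hF

theorem integral_mulVec_haarState_prod (W : UnitaryGrp n)
    {F : (Bits n → ℂ) × (Bits n → ℂ) → ℝ} (hF : Continuous F) :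
    ∫ p, F ((W : Matrix (Bits n) (Bits n) ℂ).mulVec p.1,
      (W : Matrix (Bits n) (Bits n) ℂ).mulVec p.2) ∂(haarState n).prod (haarState n) =
    ∫ p, F p ∂(haarState n).prod (haarState n) := by
  have hW := continuous_unitary_mulVec W
  conv_rhs => rw [← map_mulVec_haarState W,
    Measure.map_prod_map _ _ hW.measurable hW.measurable]
  rw [integral_map (hW.prodMap hW).measurable.aemeasurable hF.aestronglyMeasurable]
  rfl

end Product

/-- If the law `ν` of a random point of a compact set is invariant under the maps `T U`, then
averaging a continuous function over a random `U` does not change its mean. -/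
theorem integral_integral_of_invariant {X G : Type*} [TopologicalSpace X] [T2Space X]
    [SecondCountableTopology X] [MeasurableSpace X] [OpensMeasurableSpace X]
    [TopologicalSpace G] [T2Space G] [SecondCountableTopology G] [CompactSpace G]
    [MeasurableSpace G] [OpensMeasurableSpace G] (ν : Measure X) [IsProbabilityMeasure ν]
    (μ : Measure G) [IsProbabilityMeasure μ] {K : Set X} (hK : IsCompact K)
    (hν : ∀ᵐ x ∂ν, x ∈ K) (T : G → X → X) (hT : Continuous fun z : X × G => T z.2 z.1)
    {F : X → ℝ} (hF : Continuous F) (hinv : ∀ U, ∫ x, F (T U x) ∂ν = ∫ x, F x ∂ν) :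
    Integrable (fun x => ∫ U, F (T U x) ∂μ) ν ∧
      ∫ x, ∫ U, F (T U x) ∂μ ∂ν = ∫ x, F x ∂ν := by
  have hc : Continuous fun z : X × G => F (T z.2 z.1) := hF.comp hT
  have hae : ∀ᵐ z ∂ν.prod μ, z ∈ K ×ˢ (Set.univ : Set G) :=
    (Measure.ae_prod_mem_iff_ae_ae_mem (hK.prod isCompact_univ).measurableSet).mpr
      (hν.mono fun x hx => Filter.Eventually.of_forall fun U => ⟨hx, trivial⟩)
  have hi : Integrable (fun z : X × G => F (T z.2 z.1)) (ν.prod μ) :=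
    integrable_of_continuous_of_ae_mem (hK.prod isCompact_univ) hae hc
  refine ⟨hi.integral_prod_left, ?_⟩
  rw [integral_integral_swap hi]
  simp [hinv]

theorem continuous_meanSq {n : ℕ} {X : Type*} [TopologicalSpace X] (f : Bits n → Bits n → ℝ)
    (m : ℕ) {p q : X → Bits n → ℝ} (hp : Continuous p) (hq : Continuous q) :
    Continuous fun r => meanSq f m (p r) (q r) := by
  have h : ∀ {p : X → Bits n → ℝ}, Continuous p → ∀ x y,
      Continuous fun r => pairMoment m (p r) x y := by
    intro p hp x y
    unfold pairMoment
    split_ifs <;> fun_prop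
  exact continuous_const.mul (continuous_finsetSum _ fun x _ => continuous_finsetSum _ fun z _ =>
    continuous_finsetSum _ fun y _ => continuous_finsetSum _ fun w _ =>
      continuous_const.mul ((h hp x y).mul (h hq z w)))

/-- The average variance for equal states, in terms of the second moment alone. -/
theorem IsUnbiased.averageVariance₁_eq {n : ℕ} {μ : Measure (UnitaryGrp n)}
    [IsProbabilityMeasure μ] {f : Bits n → Bits n → ℝ} (hf : IsUnbiased μ f) {m : ℕ}
    (hm : 1 ≤ m) :
    Integrable (fun ψ => estimatorVariance μ f m (ketbra ψ) (ketbra ψ)) (haarState n) ∧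
      averageVariance₁ μ f m = ∫ ψ, meanSq f m (weight ψ) (weight ψ) ∂haarState n - 1 := by
  have hc : Continuous fun ψ : Bits n → ℂ => meanSq f m (weight ψ) (weight ψ) :=
    continuous_meanSq f m continuous_weight continuous_weight
  obtain ⟨hi, he⟩ := integral_integral_of_invariant (haarState n) μ (isCompact_unitVectors n)
    (ae_mem_unitVectors n) (fun U ψ => (U : Matrix (Bits n) (Bits n) ℂ).mulVec ψ)
    (continuous_mulVec_unitary.comp continuous_swap) hc
    (fun U => integral_mulVec_haarState U hc)
  have hae : (fun ψ => ∫ U : UnitaryGrp n, meanSq f m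
      (weight ((U : Matrix (Bits n) (Bits n) ℂ).mulVec ψ))
      (weight ((U : Matrix (Bits n) (Bits n) ℂ).mulVec ψ)) ∂μ - 1) =ᵐ[haarState n]
      fun ψ => estimatorVariance μ f m (ketbra ψ) (ketbra ψ) := by
    refine (ae_mem_unitVectors n).mono fun ψ hψ => ?_
    simp only [hf.estimatorVariance_eq hm (isState_ketbra hψ) (isState_ketbra hψ),
      trace_ketbra_mul_self hψ, bornProb_ketbra, one_pow]
  refine ⟨(hi.sub (integrable_const 1)).congr hae, ?_⟩
  rw [averageVariance₁, ← integral_congr_ae hae, integral_sub hi (integrable_const 1), he]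
  simp

/-- The average variance for independent states is at most the average second moment. -/
theorem IsUnbiased.averageVariance₂_le {n : ℕ} {μ : Measure (UnitaryGrp n)}
    [IsProbabilityMeasure μ] {f : Bits n → Bits n → ℝ} (hf : IsUnbiased μ f) {m : ℕ}
    (hm : 1 ≤ m) :
    Integrable (fun p => estimatorVariance μ f m (ketbra p.1) (ketbra p.2))
        ((haarState n).prod (haarState n)) ∧
      averageVariance₂ μ f m ≤
        ∫ p, meanSq f m (weight p.1) (weight p.2) ∂(haarState n).prod (haarState n) := by
  have hc : Continuous fun p : (Bits n → ℂ) × (Bits n → ℂ) =>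
      meanSq f m (weight p.1) (weight p.2) :=
    continuous_meanSq f m (continuous_weight.comp continuous_fst)
      (continuous_weight.comp continuous_snd)
  have hT : Continuous fun z : ((Bits n → ℂ) × (Bits n → ℂ)) × UnitaryGrp n =>
      ((z.2 : Matrix (Bits n) (Bits n) ℂ).mulVec z.1.1,
        (z.2 : Matrix (Bits n) (Bits n) ℂ).mulVec z.1.2) :=
    (continuous_mulVec_unitary.comp (by fun_prop :
      Continuous fun z : ((Bits n → ℂ) × (Bits n → ℂ)) × UnitaryGrp n => (z.2, z.1.1))).prodMk
    (continuous_mulVec_unitary.comp (by fun_prop :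
      Continuous fun z : ((Bits n → ℂ) × (Bits n → ℂ)) × UnitaryGrp n => (z.2, z.1.2)))
  obtain ⟨hi, he⟩ := integral_integral_of_invariant ((haarState n).prod (haarState n)) μ
    (isCompact_unitVectors_prod n) (ae_mem_unitVectors_prod n)
    (fun U p => ((U : Matrix (Bits n) (Bits n) ℂ).mulVec p.1,
        (U : Matrix (Bits n) (Bits n) ℂ).mulVec p.2)) hT hc
    (fun U => integral_mulVec_haarState_prod U hc)
  have hi2 := integrable_haarState_prod (continuous_trace_ketbra_mul (n := n))
  have hae : (fun p => ∫ U : UnitaryGrp n, meanSq f m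
      (weight ((U : Matrix (Bits n) (Bits n) ℂ).mulVec p.1))
      (weight ((U : Matrix (Bits n) (Bits n) ℂ).mulVec p.2)) ∂μ -
        (ketbra p.1 * ketbra p.2).trace.re ^ 2) =ᵐ[(haarState n).prod (haarState n)]
      fun p => estimatorVariance μ f m (ketbra p.1) (ketbra p.2) := by
    refine (ae_mem_unitVectors_prod n).mono fun p hp => ?_
    simp only [hf.estimatorVariance_eq hm (isState_ketbra hp.1) (isState_ketbra hp.2),
      bornProb_ketbra]
  refine ⟨(hi.sub hi2).congr hae, ?_⟩
  rw [averageVariance₂, ← integral_congr_ae hae, integral_sub hi hi2, he]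
  exact sub_le_self _ (integral_nonneg fun p => sq_nonneg _)

/-! ### Low-order moments -/

theorem prod_weight_pow_single {n : ℕ} (x : Bits n) (ψ : Bits n → ℂ) :
    ∏ a, weight ψ a ^ (Pi.single x 1 : Bits n → ℕ) a = weight ψ x := by
  simpa using prod_weight_pow_add_single 0 x ψ

theorem integral_weight {n : ℕ} (x : Bits n) :
    ∫ ψ, weight ψ x ∂haarState n = 1 / 2 ^ n := by
  have h := haarMoment_add_single (0 : Bits n → ℕ) x
  simp only [haarMoment, prod_weight_pow_add_single] at h
  simp at h
  field_simp
  linarith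

theorem integral_weight_two {n : ℕ} (x y : Bits n) :
    ∫ ψ, weight ψ x * weight ψ y ∂haarState n =
      (1 + if y = x then 1 else 0) / (2 ^ n * (2 ^ n + 1)) := by
  have h := haarMoment_add_single (Pi.single x 1) y
  simp only [haarMoment, prod_weight_pow_add_single, prod_weight_pow_single, integral_weight] at h
  rw [eq_div_iff (by positivity)]
  simp [Pi.single_apply] at h
  field_simp at h
  linarith

theorem integral_weight_three {n : ℕ} (x y z : Bits n) :
    ∫ ψ, weight ψ x * weight ψ y * weight ψ z ∂haarState n =
      (1 + if y = x then 1 else 0) * (1 + (if z = x then 1 else 0) + if z = y then 1 else 0) /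
        (2 ^ n * (2 ^ n + 1) * (2 ^ n + 2)) := by
  have h := haarMoment_add_single (Pi.single x 1 + Pi.single y 1) z
  simp only [haarMoment, prod_weight_pow_add_single, prod_weight_pow_single,
    integral_weight_two] at h
  rw [eq_div_iff (by positivity)]
  simp [Pi.single_apply, Finset.sum_add_distrib] at h
  field_simp at h
  linarith

theorem integral_weight_four {n : ℕ} (x y z w : Bits n) :
    ∫ ψ, weight ψ x * weight ψ y * weight ψ z * weight ψ w ∂haarState n =
      (1 + if y = x then 1 else 0) * (1 + (if z = x then 1 else 0) + if z = y then 1 else 0) *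
        (1 + (if w = x then 1 else 0) + (if w = y then 1 else 0) + if w = z then 1 else 0) /
        (2 ^ n * (2 ^ n + 1) * (2 ^ n + 2) * (2 ^ n + 3)) := by
  have h := haarMoment_add_single (Pi.single x 1 + Pi.single y 1 + Pi.single z 1) w
  simp only [haarMoment, prod_weight_pow_add_single, prod_weight_pow_single,
    integral_weight_three] at h
  rw [eq_div_iff (by positivity)]
  simp [Pi.single_apply, Finset.sum_add_distrib] at h
  field_simp at h
  linarith

/-! ### Sums over the classical function -/

theorem sum_mul_pairMoment {κ : Type*} [Fintype κ] [DecidableEq κ] (m : ℕ) (p F : κ → ℝ) (x : κ) :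
    ∑ y, F y * pairMoment m p x y = m * p x * (F x + (m - 1) * ∑ y, F y * p y) := by
  simp only [pairMoment, mul_add, Finset.sum_add_distrib, Finset.mul_sum, mul_ite, mul_zero,
    Finset.sum_ite_eq, Finset.mem_univ, if_true]
  refine congrArg₂ _ (by ring) (Finset.sum_congr rfl fun y _ => by ring)

/-- The second moment of `X_m`, split according to which of the samples coincide. -/
theorem meanSq_eq {n : ℕ} (f : Bits n → Bits n → ℝ) {m : ℕ} (hm : 1 ≤ m) (p q : Bits n → ℝ) :
    meanSq f m p q = 1 / (m : ℝ) ^ 2 *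
      ((∑ t : Bits n × Bits n, f t.1 t.2 ^ 2 * (p t.1 * q t.2)) +
        (m - 1) * (∑ t : Bits n × Bits n × Bits n,
          f t.1 t.2.1 * f t.1 t.2.2 * (p t.1 * (q t.2.1 * q t.2.2))) +
        (m - 1) * (∑ t : Bits n × Bits n × Bits n,
          f t.2.1 t.1 * f t.2.2 t.1 * (p t.2.1 * p t.2.2 * q t.1)) +
        (m - 1) ^ 2 * ∑ t : Bits n × Bits n × Bits n × Bits n,
          f t.1 t.2.1 * f t.2.2.1 t.2.2.2 *
            (p t.1 * p t.2.2.1 * (q t.2.1 * q t.2.2.2))) := by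
  have hm' : (m : ℝ) ≠ 0 := by positivity
  have h : ∀ x z, ∑ y, ∑ w, f x z * f y w * (pairMoment m p x y * pairMoment m q z w) =
      (m : ℝ) ^ 2 * (f x z ^ 2 * (p x * q z) +
        (m - 1) * (∑ w, f x z * f x w * (p x * (q z * q w))) +
        (m - 1) * (∑ y, f x z * f y z * (p x * p y * q z)) +
        (m - 1) ^ 2 * ∑ y, ∑ w, f x z * f y w * (p x * p y * (q z * q w))) := by
    intro x z
    have e : ∀ y w, f x z * f y w * (pairMoment m p x y * pairMoment m q z w) =
        f x z * pairMoment m p x y * (f y w * pairMoment m q z w) := fun y w => by ring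
    simp only [e, ← Finset.mul_sum, sum_mul_pairMoment]
    have e2 : ∀ y, f x z * pairMoment m p x y *
        (m * q z * (f y z + (m - 1) * ∑ w, f y w * q w)) =
        f x z * (m * q z) * ((f y z + (m - 1) * ∑ w, f y w * q w) * pairMoment m p x y) :=
      fun y => by ring
    simp only [e2, ← Finset.mul_sum, sum_mul_pairMoment]
    have e3 : ∑ y, (f y z + (m - 1) * ∑ w, f y w * q w) * p y =
        ∑ y, f y z * p y + (m - 1) * ∑ y, (∑ w, f y w * q w) * p y := by
      rw [Finset.mul_sum, ← Finset.sum_add_distrib]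
      exact Finset.sum_congr rfl fun y _ => by ring
    have r1 : ∑ w, f x z * f x w * (p x * (q z * q w)) =
        f x z * p x * q z * ∑ w, f x w * q w := by
      rw [Finset.mul_sum]
      exact Finset.sum_congr rfl fun w _ => by ring
    have r2 : ∑ y, f x z * f y z * (p x * p y * q z) =
        f x z * p x * q z * ∑ y, f y z * p y := by
      rw [Finset.mul_sum]
      exact Finset.sum_congr rfl fun y _ => by ring
    have r3 : ∑ y, ∑ w, f x z * f y w * (p x * p y * (q z * q w)) =
        f x z * p x * q z * ∑ y, (∑ w, f y w * q w) * p y := by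
      simp only [Finset.mul_sum, Finset.sum_mul]
      exact Finset.sum_congr rfl fun y _ => Finset.sum_congr rfl fun w _ => by ring
    rw [e3, r1, r2, r3]
    ring
  simp only [meanSq, h, ← Finset.mul_sum, Finset.sum_add_distrib, Fintype.sum_prod_type]
  rw [Finset.sum_comm (f := fun x z => ∑ y, f x z * f y z * (p x * p y * q z))]
  field_simp

/-- The properties of a classical function that follow from unbiasedness: `f` is a convolution
kernel with row sums one and the value `D = 2 ^ n` on the diagonal. Here `N` is the sum of the
squares of a row, that is, `normSq f`. -/
structure IsClassicalKernel {κ : Type*} [Fintype κ] (f : κ → κ → ℝ) (D N : ℝ) : Prop where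
  card : (Fintype.card κ : ℝ) = D
  symm : ∀ a b, f a b = f b a
  sum_eq : ∀ a, ∑ b, f a b = 1
  diag : ∀ a, f a a = D
  sum_sq : ∀ a, ∑ b, f a b ^ 2 = N

namespace IsClassicalKernel

variable {κ : Type*} [Fintype κ] {f : κ → κ → ℝ} {D N : ℝ}

theorem sum_mul_sum_indicator₁ [DecidableEq κ] (h : IsClassicalKernel f D N) (x z : κ) :
    ∑ w, f x w * (1 + (if w = x then 1 else 0) + if w = z then 1 else 0) = 1 + D + f x z := by
  simp [mul_add, Finset.sum_add_distrib, h.sum_eq, h.diag]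

/-- The contraction of `f ⊗ f`, with a shared first argument, with the numerator of the third Haar
moment (`integral_weight_three`). -/
theorem sum_three [DecidableEq κ] (h : IsClassicalKernel f D N) :
    ∑ t : κ × κ × κ, f t.1 t.2.1 * f t.1 t.2.2 * ((1 + if t.2.1 = t.1 then 1 else 0) *
      (1 + (if t.2.2 = t.1 then 1 else 0) + if t.2.2 = t.2.1 then 1 else 0)) =
      D * ((1 + D) ^ 2 + N + D ^ 2) := by
  simp only [Fintype.sum_prod_type]
  have e : ∀ x z w, f x z * f x w * ((1 + if z = x then (1 : ℝ) else 0) *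
      (1 + (if w = x then 1 else 0) + if w = z then 1 else 0)) =
      f x z * (1 + if z = x then 1 else 0) *
        (f x w * (1 + (if w = x then 1 else 0) + if w = z then 1 else 0)) := fun x z w => by ring
  have e2 : ∀ x, ∑ z, f x z * (1 + if z = x then 1 else 0) * (1 + D + f x z) =
      (1 + D) ^ 2 + N + D ^ 2 := by
    intro x
    have e3 : ∀ z, f x z * (1 + if z = x then 1 else 0) * (1 + D + f x z) =
        f x z * (1 + D) + f x z ^ 2 + if z = x then f x z * (1 + D + f x z) else 0 := by
      intro z; split_ifs <;> ring
    simp only [e3, Finset.sum_add_distrib, ← Finset.sum_mul, h.sum_eq, h.sum_sq,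
      Finset.sum_ite_eq', Finset.mem_univ, if_true, h.diag]
    ring
  simp only [e, ← Finset.mul_sum, h.sum_mul_sum_indicator₁, e2, Finset.sum_const,
    Finset.card_univ, nsmul_eq_mul, h.card]

/-- The contraction of `f ⊗ f` with the numerator of the fourth Haar moment
(`integral_weight_four`). -/
theorem sum_four [DecidableEq κ] (h : IsClassicalKernel f D N) :
    ∑ t : κ × κ × κ × κ, f t.1 t.2.1 * f t.2.2.1 t.2.2.2 *
      ((1 + if t.2.1 = t.1 then 1 else 0) *
      (1 + (if t.2.2.1 = t.1 then 1 else 0) + if t.2.2.1 = t.2.1 then 1 else 0) *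
      (1 + (if t.2.2.2 = t.1 then 1 else 0) + (if t.2.2.2 = t.2.1 then 1 else 0) +
        if t.2.2.2 = t.2.2.1 then 1 else 0)) =
      D * (D ^ 3 + 8 * D ^ 2 + 9 * D + 4 + 2 * N) := by
  simp only [Fintype.sum_prod_type]
  have e : ∀ x z y w, f x z * f y w * ((1 + if z = x then (1 : ℝ) else 0) *
      (1 + (if y = x then 1 else 0) + if y = z then 1 else 0) *
      (1 + (if w = x then 1 else 0) + (if w = z then 1 else 0) + if w = y then 1 else 0)) =
      f x z * (1 + if z = x then 1 else 0) *
      ((1 + (if y = x then 1 else 0) + if y = z then 1 else 0) *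
        (f y w * (1 + (if w = x then 1 else 0) + (if w = z then 1 else 0) +
          if w = y then 1 else 0))) := fun x z y w => by ring
  have e2 : ∀ x z y, ∑ w, f y w * (1 + (if w = x then 1 else 0) + (if w = z then 1 else 0) +
      if w = y then 1 else 0) = 1 + f y x + f y z + D := by
    intro x z y
    simp [mul_add, Finset.sum_add_distrib, h.sum_eq, h.diag]
  have hs : ∀ x, ∑ y, f y x = 1 := fun x => by simp only [h.symm _ x, h.sum_eq]
  have e3 : ∀ x z, ∑ y, (1 + (if y = x then 1 else 0) + if y = z then 1 else 0) *
      (1 + f y x + f y z + D) = D ^ 2 + 5 * D + 4 + 2 * f x z := by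
    intro x z
    simp only [add_mul, one_mul, ite_mul, zero_mul, Finset.sum_add_distrib, Finset.sum_ite_eq',
      Finset.mem_univ, if_true, hs, h.diag, Finset.sum_const, Finset.card_univ, nsmul_eq_mul,
      h.card, h.symm z x]
    ring
  have e4 : ∀ x, ∑ z, f x z * (1 + if z = x then 1 else 0) *
      (D ^ 2 + 5 * D + 4 + 2 * f x z) = D ^ 3 + 8 * D ^ 2 + 9 * D + 4 + 2 * N := by
    intro x
    have e5 : ∀ z, f x z * (1 + if z = x then 1 else 0) * (D ^ 2 + 5 * D + 4 + 2 * f x z) =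
        f x z * (D ^ 2 + 5 * D + 4) + 2 * f x z ^ 2 +
          if z = x then f x z * (D ^ 2 + 5 * D + 4 + 2 * f x z) else 0 := by
      intro z; split_ifs <;> ring
    simp only [e5, Finset.sum_add_distrib, ← Finset.sum_mul, ← Finset.mul_sum, h.sum_eq, h.sum_sq,
      Finset.sum_ite_eq', Finset.mem_univ, if_true, h.diag]
    ring
  simp only [e, ← Finset.mul_sum, e2, e3, e4, Finset.sum_const,
    Finset.card_univ, nsmul_eq_mul, h.card]

theorem sum_two [DecidableEq κ] (h : IsClassicalKernel f D N) :
    ∑ t : κ × κ, f t.1 t.2 ^ 2 * (1 + if t.2 = t.1 then 1 else 0) = D * (N + D ^ 2) := by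
  simp [Fintype.sum_prod_type, mul_add, Finset.sum_add_distrib, h.sum_sq, h.diag, h.card]

theorem sum_sq_sum (h : IsClassicalKernel f D N) : ∑ t : κ × κ, f t.1 t.2 ^ 2 = D * N := by
  simp [Fintype.sum_prod_type, h.sum_sq, h.card]

theorem sum_three_indep [DecidableEq κ] (h : IsClassicalKernel f D N) :
    ∑ t : κ × κ × κ, f t.1 t.2.1 * f t.1 t.2.2 * (1 + if t.2.2 = t.2.1 then 1 else 0) =
      D * (1 + N) := by
  simp only [Fintype.sum_prod_type]
  have e : ∀ x z, ∑ w, f x z * f x w * (1 + if w = z then 1 else 0) = f x z + f x z ^ 2 := by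
    intro x z
    simp only [mul_assoc, ← Finset.mul_sum]
    simp [mul_add, Finset.sum_add_distrib, h.sum_eq]
    ring
  simp [e, Finset.sum_add_distrib, h.sum_eq, h.sum_sq, h.card]
  ring

theorem sum_four_indep [DecidableEq κ] (h : IsClassicalKernel f D N) :
    ∑ t : κ × κ × κ × κ, f t.1 t.2.1 * f t.2.2.1 t.2.2.2 *
      ((1 + if t.2.2.1 = t.1 then 1 else 0) * (1 + if t.2.2.2 = t.2.1 then 1 else 0)) =
      D * (D + 2 + N) := by
  simp only [Fintype.sum_prod_type]
  have hs : ∀ x, ∑ y, f y x = 1 := fun x => by simp only [h.symm _ x, h.sum_eq]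
  have e : ∀ x z y, ∑ w, f x z * f y w * ((1 + if y = x then 1 else 0) *
      (1 + if w = z then 1 else 0)) = f x z * ((1 + if y = x then 1 else 0) * (1 + f y z)) := by
    intro x z y
    have e1 : ∑ w, f y w * (1 + if w = z then 1 else 0) = 1 + f y z := by
      simp [mul_add, Finset.sum_add_distrib, h.sum_eq]
    rw [← e1, Finset.mul_sum, Finset.mul_sum]
    exact Finset.sum_congr rfl fun w _ => by ring
  have e2 : ∀ x z, ∑ y, (1 + if y = x then 1 else 0) * (1 + f y z) = D + 2 + f x z := by
    intro x z
    simp only [add_mul, mul_add, one_mul, mul_one, ite_mul, zero_mul, Finset.sum_add_distrib,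
      Finset.sum_ite_eq', Finset.mem_univ, if_true, hs, Finset.sum_const, Finset.card_univ,
      nsmul_eq_mul, h.card]
    ring
  have e3 : ∀ x z, f x z * (D + 2 + f x z) = f x z * (D + 2) + f x z ^ 2 := fun x z => by ring
  simp only [e, ← Finset.mul_sum, e2, e3, Finset.sum_add_distrib, ← Finset.sum_mul, h.sum_eq,
    h.sum_sq, Finset.sum_const, Finset.card_univ, nsmul_eq_mul, h.card]
  ring

end IsClassicalKernel

theorem isState_maximallyMixed (n : ℕ) :
    IsState ((((2 : ℝ) ^ n)⁻¹ : ℝ) • (1 : Matrix (Bits n) (Bits n) ℂ)) := by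
  refine ⟨Matrix.PosSemidef.one.smul (by positivity), ?_⟩
  simp [Matrix.trace_smul]

theorem bornProb_maximallyMixed {n : ℕ} (U : UnitaryGrp n) (a : Bits n) :
    bornProb U ((((2 : ℝ) ^ n)⁻¹ : ℝ) • (1 : Matrix (Bits n) (Bits n) ℂ)) a = ((2 : ℝ) ^ n)⁻¹ := by
  have h : (U : Matrix (Bits n) (Bits n) ℂ) * (U : Matrix (Bits n) (Bits n) ℂ).conjTranspose = 1 :=
    by simpa [Matrix.star_eq_conjTranspose] using Matrix.mem_unitaryGroup_iff.mp U.2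
  rw [bornProb, Matrix.mul_smul, Matrix.smul_mul, mul_one, h, Matrix.smul_apply,
    Matrix.one_apply_eq, Complex.smul_re, Complex.one_re, smul_eq_mul, mul_one]

/-- Unbiasedness at the maximally mixed state forces the constant row sum of `f` to be one. -/
theorem IsUnbiased.sum_eq_one {n : ℕ} {μ : Measure (UnitaryGrp n)}
    [IsProbabilityMeasure μ] {f : Bits n → Bits n → ℝ} (hf : IsUnbiased μ f)
    {c : ℝ} (hrow : ∀ a, ∑ b, f a b = c) : c = 1 := by
  have h := hf.integral_sum (isState_maximallyMixed n) (isState_maximallyMixed n)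
  rw [Matrix.smul_mul, one_mul, Matrix.trace_smul, (isState_maximallyMixed n).2, Complex.smul_re,
    Complex.one_re, smul_eq_mul, mul_one] at h
  simp only [bornProb_maximallyMixed, ← Finset.sum_mul, hrow] at h
  simp at h
  field_simp at h
  exact h

theorem integral_sum_mul {X ι : Type*} [MeasurableSpace X] [Fintype ι] (ν : Measure X) (c : ι → ℝ)
    (F : ι → X → ℝ) (hF : ∀ i, Integrable (F i) ν) :
    ∫ x, ∑ i, c i * F i x ∂ν = ∑ i, c i * ∫ x, F i x ∂ν := by
  rw [integral_finsetSum _ fun i _ => (hF i).const_mul _]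
  simp only [integral_const_mul]

theorem integral_linear_combination {X : Type*} [MeasurableSpace X] {ν : Measure X}
    {A B B' C : X → ℝ} (hA : Integrable A ν) (hB : Integrable B ν) (hB' : Integrable B' ν)
    (hC : Integrable C ν) (r s : ℝ) :
    ∫ x, A x + r * B x + r * B' x + s * C x ∂ν =
      ∫ x, A x ∂ν + r * ∫ x, B x ∂ν + r * ∫ x, B' x ∂ν + s * ∫ x, C x ∂ν := by
  have h1 : Integrable (fun x => A x + r * B x) ν := hA.add (hB.const_mul r)
  have h2 : Integrable (fun x => A x + r * B x + r * B' x) ν := h1.add (hB'.const_mul r)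
  rw [integral_add h2 (hC.const_mul s), integral_add h1 (hB'.const_mul r),
    integral_add hA (hB.const_mul r), integral_const_mul, integral_const_mul, integral_const_mul]

/-- Averaging unbiasedness at equal pure states over Haar random states gives
`f (0, 0) = 2 ^ n`. -/
theorem IsUnbiased.diag_eq {n : ℕ} {μ : Measure (UnitaryGrp n)}
    [IsProbabilityMeasure μ] {f : Bits n → Bits n → ℝ} (hf : IsUnbiased μ f)
    (hrow : ∀ a, ∑ b, f a b = 1) (hdiag : ∀ a, f a a = f 0 0) : f 0 0 = 2 ^ n := by
  have hw : ∀ x : Bits n, Continuous fun ψ : Bits n → ℂ => weight ψ x :=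
    fun x => (continuous_apply x).comp continuous_weight
  have hc : Continuous fun ψ : Bits n → ℂ =>
      ∑ x, ∑ z, f x z * (weight ψ x * weight ψ z) := by fun_prop
  obtain ⟨-, he⟩ := integral_integral_of_invariant (haarState n) μ (isCompact_unitVectors n)
    (ae_mem_unitVectors n) (fun U ψ => (U : Matrix (Bits n) (Bits n) ℂ).mulVec ψ)
    (continuous_mulVec_unitary.comp continuous_swap) hc
    (fun U => integral_mulVec_haarState U hc)
  have h1 : ∫ ψ, ∑ x, ∑ z, f x z * (weight ψ x * weight ψ z) ∂haarState n = 1 := by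
    rw [← he]
    refine (integral_congr_ae ((ae_mem_unitVectors n).mono fun ψ hψ => ?_)).trans
      (integral_const (1 : ℝ)) |>.trans (by simp)
    have := hf.integral_sum (isState_ketbra hψ) (isState_ketbra hψ)
    simpa only [bornProb_ketbra, trace_ketbra_mul_self hψ] using this
  simp only [← Fintype.sum_prod_type'] at h1
  rw [integral_sum_mul (haarState n) (fun t : Bits n × Bits n => f t.1 t.2)
    (fun t ψ => weight ψ t.1 * weight ψ t.2)
    (fun t => integrable_haarState ((hw _).mul (hw _)))] at h1
  simp only [integral_weight_two, Fintype.sum_prod_type, ← mul_div_assoc, ← Finset.sum_div,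
    mul_add, mul_ite, mul_one, mul_zero, Finset.sum_add_distrib, Finset.sum_ite_eq',
    Finset.mem_univ, if_true, hrow, hdiag, Finset.sum_const, Finset.card_univ] at h1
  simp at h1
  field_simp at h1
  linarith

theorem isClassicalKernel {n : ℕ} {μ : Measure (UnitaryGrp n)}
    [IsProbabilityMeasure μ] {f : Bits n → Bits n → ℝ} (hf : IsUnbiased μ f)
    (hadd : ∀ a b, f a b = f (a + b) 0) : IsClassicalKernel f (2 ^ n) (normSq f) := by
  have hsum : ∀ (g : ℝ → ℝ) a, ∑ b, g (f a b) = ∑ c, g (f c 0) := by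
    intro g a
    rw [← Equiv.sum_comp (Equiv.addLeft a) fun c => g (f c 0)]
    exact Finset.sum_congr rfl fun b _ => by rw [hadd a b]; rfl
  have hself : ∀ a : Bits n, a + a = 0 := fun a => funext fun i => CharTwo.add_self_eq_zero (a i)
  have hdiag : ∀ a, f a a = f 0 0 := fun a => by rw [hadd, hself]
  have hrow : ∀ a, ∑ b, f a b = 1 := fun a =>
    (hsum id a).trans (hf.sum_eq_one (hsum id))
  exact
    { card := by simp
      symm := fun a b => by rw [hadd a b, hadd b a, add_comm]
      sum_eq := hrow
      diag := fun a => (hdiag a).trans (hf.diag_eq hrow hdiag)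
      sum_sq := fun a => hsum (· ^ 2) a }

/-! ### Average second moments -/

theorem IsClassicalKernel.integral_meanSq_self {n : ℕ} {f : Bits n → Bits n → ℝ} {N : ℝ}
    (h : IsClassicalKernel f (2 ^ n) N) {m : ℕ} (hm : 1 ≤ m) :
    ∫ ψ, meanSq f m (weight ψ) (weight ψ) ∂haarState n = 1 / (m : ℝ) ^ 2 *
      ((N + (2 ^ n) ^ 2) / (2 ^ n + 1) +
        2 * (m - 1) * (((1 + 2 ^ n) ^ 2 + N + (2 ^ n) ^ 2) / ((2 ^ n + 1) * (2 ^ n + 2))) +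
        (m - 1) ^ 2 * (((2 ^ n) ^ 3 + 8 * (2 ^ n) ^ 2 + 9 * 2 ^ n + 4 + 2 * N) /
          ((2 ^ n + 1) * (2 ^ n + 2) * (2 ^ n + 3)))) := by
  have hw : ∀ x : Bits n, Continuous fun ψ : Bits n → ℂ => weight ψ x :=
    fun x => (continuous_apply x).comp continuous_weight
  have hs := h.symm
  have h3 : ∀ ψ : Bits n → ℂ, ∑ t : Bits n × Bits n × Bits n,
      f t.2.1 t.1 * f t.2.2 t.1 * (weight ψ t.2.1 * weight ψ t.2.2 * weight ψ t.1) =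
      ∑ t : Bits n × Bits n × Bits n,
        f t.1 t.2.1 * f t.1 t.2.2 * (weight ψ t.1 * (weight ψ t.2.1 * weight ψ t.2.2)) :=
    fun ψ => Finset.sum_congr rfl fun t _ => by rw [hs t.2.1 t.1, hs t.2.2 t.1]; ring
  have i2 := integral_sum_mul (haarState n) (fun t : Bits n × Bits n => f t.1 t.2 ^ 2)
    (fun t ψ => weight ψ t.1 * weight ψ t.2)
    (fun t => integrable_haarState (by fun_prop))
  have i3 := integral_sum_mul (haarState n)
    (fun t : Bits n × Bits n × Bits n => f t.1 t.2.1 * f t.1 t.2.2)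
    (fun t ψ => weight ψ t.1 * (weight ψ t.2.1 * weight ψ t.2.2))
    (fun t => integrable_haarState (by fun_prop))
  have i4 := integral_sum_mul (haarState n)
    (fun t : Bits n × Bits n × Bits n × Bits n => f t.1 t.2.1 * f t.2.2.1 t.2.2.2)
    (fun t ψ => weight ψ t.1 * weight ψ t.2.2.1 * (weight ψ t.2.1 * weight ψ t.2.2.2))
    (fun t => integrable_haarState (by fun_prop))
  have k3 : ∀ x y z : Bits n, ∫ ψ, weight ψ x * (weight ψ y * weight ψ z) ∂haarState n =
      (1 + if y = x then 1 else 0) * (1 + (if z = x then 1 else 0) + if z = y then 1 else 0) /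
        (2 ^ n * (2 ^ n + 1) * (2 ^ n + 2)) := fun x y z => by
    simp only [← mul_assoc, integral_weight_three]
  have k4 : ∀ x z y w : Bits n,
      ∫ ψ, weight ψ x * weight ψ y * (weight ψ z * weight ψ w) ∂haarState n =
      (1 + if z = x then 1 else 0) * (1 + (if y = x then 1 else 0) + if y = z then 1 else 0) *
        (1 + (if w = x then 1 else 0) + (if w = z then 1 else 0) + if w = y then 1 else 0) /
        (2 ^ n * (2 ^ n + 1) * (2 ^ n + 2) * (2 ^ n + 3)) := fun x z y w => by
    rw [← integral_weight_four x z y w]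
    exact integral_congr_ae (Filter.Eventually.of_forall fun ψ => by ring)
  simp only [integral_weight_two, k3, k4, ← mul_div_assoc,
    ← Finset.sum_div, h.sum_two, h.sum_three, h.sum_four] at i2 i3 i4
  have c2 : Continuous fun ψ : Bits n → ℂ => ∑ t : Bits n × Bits n,
    f t.1 t.2 ^ 2 * (weight ψ t.1 * weight ψ t.2) := by fun_prop
  have c3 : Continuous fun ψ : Bits n → ℂ => ∑ t : Bits n × Bits n × Bits n,
    f t.1 t.2.1 * f t.1 t.2.2 * (weight ψ t.1 * (weight ψ t.2.1 * weight ψ t.2.2)) := by fun_prop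
  have c4 : Continuous fun ψ : Bits n → ℂ => ∑ t : Bits n × Bits n × Bits n × Bits n,
    f t.1 t.2.1 * f t.2.2.1 t.2.2.2 *
      (weight ψ t.1 * weight ψ t.2.2.1 * (weight ψ t.2.1 * weight ψ t.2.2.2)) := by fun_prop
  simp only [meanSq_eq f hm, h3]
  rw [integral_const_mul, integral_linear_combination (integrable_haarState c2)
    (integrable_haarState c3) (integrable_haarState c3) (integrable_haarState c4), i2, i3, i4]
  field_simp
  ring

theorem IsClassicalKernel.integral_meanSq_prod {n : ℕ} {f : Bits n → Bits n → ℝ} {N : ℝ}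
    (h : IsClassicalKernel f (2 ^ n) N) {m : ℕ} (hm : 1 ≤ m) :
    ∫ p, meanSq f m (weight p.1) (weight p.2) ∂(haarState n).prod (haarState n) =
      1 / (m : ℝ) ^ 2 * (N / 2 ^ n + 2 * (m - 1) * ((1 + N) / (2 ^ n * (2 ^ n + 1))) +
        (m - 1) ^ 2 * ((2 ^ n + 2 + N) / (2 ^ n * (2 ^ n + 1) ^ 2))) := by
  have hw : ∀ x : Bits n, Continuous fun ψ : Bits n → ℂ => weight ψ x :=
    fun x => (continuous_apply x).comp continuous_weight
  have hs := h.symm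
  have h1 : ∀ x : Bits n, Continuous fun p : (Bits n → ℂ) × (Bits n → ℂ) => weight p.1 x :=
    fun x => (hw x).comp continuous_fst
  have h2 : ∀ x : Bits n, Continuous fun p : (Bits n → ℂ) × (Bits n → ℂ) => weight p.2 x :=
    fun x => (hw x).comp continuous_snd
  have i2 := integral_sum_mul ((haarState n).prod (haarState n))
    (fun t : Bits n × Bits n => f t.1 t.2 ^ 2)
    (fun t p => weight p.1 t.1 * weight p.2 t.2)
    (fun t => integrable_haarState_prod (by fun_prop))
  have i3 := integral_sum_mul ((haarState n).prod (haarState n))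
    (fun t : Bits n × Bits n × Bits n => f t.1 t.2.1 * f t.1 t.2.2)
    (fun t p => weight p.1 t.1 * (weight p.2 t.2.1 * weight p.2 t.2.2))
    (fun t => integrable_haarState_prod (by fun_prop))
  have i3' := integral_sum_mul ((haarState n).prod (haarState n))
    (fun t : Bits n × Bits n × Bits n => f t.2.1 t.1 * f t.2.2 t.1)
    (fun t p => weight p.1 t.2.1 * weight p.1 t.2.2 * weight p.2 t.1)
    (fun t => integrable_haarState_prod (by fun_prop))
  have i4 := integral_sum_mul ((haarState n).prod (haarState n))
    (fun t : Bits n × Bits n × Bits n × Bits n => f t.1 t.2.1 * f t.2.2.1 t.2.2.2)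
    (fun t p => weight p.1 t.1 * weight p.1 t.2.2.1 * (weight p.2 t.2.1 * weight p.2 t.2.2.2))
    (fun t => integrable_haarState_prod (by fun_prop))
  have k2 : ∀ x z, ∫ p, weight p.1 x * weight p.2 z ∂(haarState n).prod (haarState n) =
      1 / (2 ^ n * 2 ^ n) := fun x z => by
    rw [integral_prod_mul (fun ψ => weight ψ x) (fun ψ => weight ψ z)]
    simp only [integral_weight]
    field_simp
  have k3 : ∀ x z w, ∫ p, weight p.1 x * (weight p.2 z * weight p.2 w)
      ∂(haarState n).prod (haarState n) =
      (1 + if w = z then 1 else 0) / (2 ^ n * (2 ^ n * (2 ^ n + 1))) := fun x z w => by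
    rw [integral_prod_mul (fun ψ => weight ψ x) (fun ψ => weight ψ z * weight ψ w)]
    simp only [integral_weight, integral_weight_two]
    field_simp
  have k3' : ∀ z x y, ∫ p, weight p.1 x * weight p.1 y * weight p.2 z
      ∂(haarState n).prod (haarState n) =
      (1 + if y = x then 1 else 0) / (2 ^ n * (2 ^ n * (2 ^ n + 1))) := fun z x y => by
    rw [integral_prod_mul (fun ψ => weight ψ x * weight ψ y) (fun ψ => weight ψ z)]
    simp only [integral_weight, integral_weight_two]
    field_simp
  have k4 : ∀ x z y w, ∫ p, weight p.1 x * weight p.1 y * (weight p.2 z * weight p.2 w)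
      ∂(haarState n).prod (haarState n) =
      (1 + if y = x then 1 else 0) * (1 + if w = z then 1 else 0) /
        (2 ^ n * (2 ^ n + 1)) ^ 2 := fun x z y w => by
    rw [integral_prod_mul (fun ψ => weight ψ x * weight ψ y) (fun ψ => weight ψ z * weight ψ w)]
    simp only [integral_weight_two]
    field_simp
  have s3' : ∑ t : Bits n × Bits n × Bits n, f t.2.1 t.1 * f t.2.2 t.1 *
      (1 + if t.2.2 = t.2.1 then 1 else 0) = 2 ^ n * (1 + N) := by
    rw [← h.sum_three_indep]
    exact Finset.sum_congr rfl fun t _ => by rw [hs t.2.1 t.1, hs t.2.2 t.1]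
  simp only [k2, k3, k3', k4, ← mul_div_assoc, mul_one,
    ← Finset.sum_div, h.sum_sq_sum, h.sum_three_indep, s3', h.sum_four_indep] at i2 i3 i3' i4
  have c2 : Continuous fun p : (Bits n → ℂ) × (Bits n → ℂ) => ∑ t : Bits n × Bits n,
    f t.1 t.2 ^ 2 * (weight p.1 t.1 * weight p.2 t.2) := by fun_prop
  have c3 : Continuous fun p : (Bits n → ℂ) × (Bits n → ℂ) => ∑ t : Bits n × Bits n × Bits n,
    f t.1 t.2.1 * f t.1 t.2.2 * (weight p.1 t.1 * (weight p.2 t.2.1 * weight p.2 t.2.2)) := by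
    fun_prop
  have c3' : Continuous fun p : (Bits n → ℂ) × (Bits n → ℂ) => ∑ t : Bits n × Bits n × Bits n,
    f t.2.1 t.1 * f t.2.2 t.1 * (weight p.1 t.2.1 * weight p.1 t.2.2 * weight p.2 t.1) := by
    fun_prop
  have c4 : Continuous fun p : (Bits n → ℂ) × (Bits n → ℂ) =>
    ∑ t : Bits n × Bits n × Bits n × Bits n, f t.1 t.2.1 * f t.2.2.1 t.2.2.2 *
      (weight p.1 t.1 * weight p.1 t.2.2.1 * (weight p.2 t.2.1 * weight p.2 t.2.2.2)) := by
    fun_prop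
  simp only [meanSq_eq f hm]
  rw [integral_const_mul, integral_linear_combination (integrable_haarState_prod c2)
    (integrable_haarState_prod c3) (integrable_haarState_prod c3') (integrable_haarState_prod c4),
    i2, i3, i3', i4]
  field_simp
  ring

/-! ### The final estimates -/

/-- The average second moment for equal states exceeds one only by error terms: the fourth-order
fraction is at most `1 + 4 N / D ^ 3`. -/
theorem average_self_le {D N M : ℝ} (hD : 1 ≤ D) (hN : D ^ 2 ≤ N) (hM : 1 ≤ M) :
    1 / M ^ 2 * ((N + D ^ 2) / (D + 1) +
        2 * (M - 1) * (((1 + D) ^ 2 + N + D ^ 2) / ((D + 1) * (D + 2))) +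
        (M - 1) ^ 2 * ((D ^ 3 + 8 * D ^ 2 + 9 * D + 4 + 2 * N) /
          ((D + 1) * (D + 2) * (D + 3)))) - 1 ≤
      12 * (N / (D * M ^ 2) + N / (D ^ 2 * M) + N / D ^ 3) := by
  have hN0 : 0 ≤ N := (sq_nonneg D).trans hN
  have h1 : (N + D ^ 2) / (D + 1) ≤ 2 * (N / D) := by
    rw [← mul_div_assoc, div_le_div_iff₀ (by positivity) (by positivity)]
    nlinarith
  have h2 : ((1 + D) ^ 2 + N + D ^ 2) / ((D + 1) * (D + 2)) ≤ 6 * (N / D ^ 2) := by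
    rw [← mul_div_assoc]
    exact div_le_div₀ (by positivity) (by nlinarith) (by positivity) (by nlinarith)
  have h3 : (D ^ 3 + 8 * D ^ 2 + 9 * D + 4 + 2 * N) / ((D + 1) * (D + 2) * (D + 3)) ≤
      1 + 4 * (N / D ^ 3) := by
    rw [← mul_div_assoc, ← sub_le_iff_le_add', div_sub_one (by positivity)]
    exact div_le_div₀ (by positivity) (by nlinarith) (by positivity) (by nlinarith [sq_nonneg D])
  have hM0 : 0 < M := by linarith
  have h4 : 0 ≤ 1 + 4 * (N / D ^ 3) := by positivity
  have e1 : (M - 1) / M ^ 2 ≤ 1 / M := by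
    rw [div_le_div_iff₀ (by positivity) hM0]; nlinarith
  have e2 : (M - 1) ^ 2 / M ^ 2 ≤ 1 := by
    rw [div_le_one (by positivity)]; nlinarith
  calc _ ≤ 1 / M ^ 2 * (2 * (N / D) + 2 * (M - 1) * (6 * (N / D ^ 2)) +
        (M - 1) ^ 2 * (1 + 4 * (N / D ^ 3))) - 1 := by
        have : 0 ≤ M - 1 := by linarith
        gcongr
    _ = 2 * (N / (D * M ^ 2)) + 12 * (N / D ^ 2) * ((M - 1) / M ^ 2) +
        (M - 1) ^ 2 / M ^ 2 * (1 + 4 * (N / D ^ 3)) - 1 := by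
        field_simp
        ring
    _ ≤ 2 * (N / (D * M ^ 2)) + 12 * (N / D ^ 2) * (1 / M) + 1 * (1 + 4 * (N / D ^ 3)) - 1 := by
        gcongr
    _ = 2 * (N / (D * M ^ 2)) + 12 * (N / (D ^ 2 * M)) + 4 * (N / D ^ 3) := by
        field_simp
        ring
    _ ≤ _ := by
        have a1 : 0 ≤ N / (D * M ^ 2) := by positivity
        have a2 : 0 ≤ N / D ^ 3 := by positivity
        linarith

theorem average_prod_le {D N M : ℝ} (hD : 1 ≤ D) (hN : D ^ 2 ≤ N) (hM : 1 ≤ M) :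
    1 / M ^ 2 * (N / D + 2 * (M - 1) * ((1 + N) / (D * (D + 1))) +
        (M - 1) ^ 2 * ((D + 2 + N) / (D * (D + 1) ^ 2))) ≤
      12 * (N / (D * M ^ 2) + N / (D ^ 2 * M) + N / D ^ 3) := by
  have hN0 : 0 ≤ N := (sq_nonneg D).trans hN
  have h2 : (1 + N) / (D * (D + 1)) ≤ 2 * (N / D ^ 2) := by
    rw [← mul_div_assoc]
    exact div_le_div₀ (by positivity) (by nlinarith) (by positivity) (by nlinarith)
  have h3 : (D + 2 + N) / (D * (D + 1) ^ 2) ≤ 4 * (N / D ^ 3) := by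
    rw [← mul_div_assoc]
    exact div_le_div₀ (by positivity) (by nlinarith) (by positivity) (by nlinarith [sq_nonneg D])
  have hM0 : 0 < M := by linarith
  have e1 : (M - 1) / M ^ 2 ≤ 1 / M := by
    rw [div_le_div_iff₀ (by positivity) hM0]; nlinarith
  have e2 : (M - 1) ^ 2 / M ^ 2 ≤ 1 := by
    rw [div_le_one (by positivity)]; nlinarith
  calc _ ≤ 1 / M ^ 2 * (N / D + 2 * (M - 1) * (2 * (N / D ^ 2)) +
        (M - 1) ^ 2 * (4 * (N / D ^ 3))) := by
        have : 0 ≤ M - 1 := by linarith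
        gcongr
    _ = N / (D * M ^ 2) + 4 * (N / D ^ 2) * ((M - 1) / M ^ 2) +
        (M - 1) ^ 2 / M ^ 2 * (4 * (N / D ^ 3)) := by
        field_simp
        ring
    _ ≤ N / (D * M ^ 2) + 4 * (N / D ^ 2) * (1 / M) + 1 * (4 * (N / D ^ 3)) := by
        gcongr
    _ = N / (D * M ^ 2) + 4 * (N / (D ^ 2 * M)) + 4 * (N / D ^ 3) := by
        field_simp
    _ ≤ _ := by
        have a1 : 0 ≤ N / (D * M ^ 2) := by positivity
        have a2 : 0 ≤ N / D ^ 3 := by positivity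
        have a3 : 0 ≤ N / (D ^ 2 * M) := by positivity
        linarith

end DIPE

end

theorem mainTheorem2 :
    ∃ C : ℝ, 0 < C ∧
      ∀ (n m : ℕ), 1 ≤ m →
      ∀ (μ : MeasureTheory.Measure (DIPE.UnitaryGrp n)), MeasureTheory.IsProbabilityMeasure μ →
        DIPE.IsPauliInvariant μ →
      ∀ f : DIPE.Bits n → DIPE.Bits n → ℝ,
        DIPE.IsUnbiased μ f → (∀ a b, f a b = f (a + b) 0) →
        (MeasureTheory.Integrable
            (fun ψ => DIPE.estimatorVariance μ f m (DIPE.ketbra ψ) (DIPE.ketbra ψ))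
            (DIPE.haarState n) ∧
          DIPE.averageVariance₁ μ f m ≤
            C * (DIPE.normSq f / (2 ^ n * (m : ℝ) ^ 2) + DIPE.normSq f / (4 ^ n * (m : ℝ))
              + DIPE.normSq f / 8 ^ n + f 0 0 ^ 2 / 4 ^ n - 1)) ∧
        (MeasureTheory.Integrable
            (fun p => DIPE.estimatorVariance μ f m (DIPE.ketbra p.1) (DIPE.ketbra p.2))
            ((DIPE.haarState n).prod (DIPE.haarState n)) ∧
          DIPE.averageVariance₂ μ f m ≤
            C * (DIPE.normSq f / (2 ^ n * (m : ℝ) ^ 2) + DIPE.normSq f / (4 ^ n * (m : ℝ))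
              + DIPE.normSq f / 8 ^ n)) := by
  refine ⟨12, by norm_num, fun n m hm μ _ _ f hf hadd => ?_⟩
  have hk := DIPE.isClassicalKernel hf hadd
  obtain ⟨i₁, e₁⟩ := hf.averageVariance₁_eq hm
  obtain ⟨i₂, l₂⟩ := hf.averageVariance₂_le hm
  have hD : (1 : ℝ) ≤ 2 ^ n := one_le_pow₀ one_le_two
  have hM : (1 : ℝ) ≤ m := by exact_mod_cast hm
  have h4 : (4 : ℝ) ^ n = (2 ^ n) ^ 2 := by rw [← pow_mul, mul_comm, pow_mul]; norm_num
  have h8 : (8 : ℝ) ^ n = (2 ^ n) ^ 3 := by rw [← pow_mul, mul_comm, pow_mul]; norm_num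
  have hN : ((2 : ℝ) ^ n) ^ 2 ≤ DIPE.normSq f := by
    rw [← hk.diag 0]
    exact Finset.single_le_sum (f := fun a => f a 0 ^ 2) (fun a _ => sq_nonneg _)
      (Finset.mem_univ 0)
  refine ⟨⟨i₁, ?_⟩, i₂, l₂.trans ?_⟩
  · -- The terms `f (0, 0) ^ 2 / 4 ^ n - 1` cancel, since `f (0, 0) = 2 ^ n`.
    rw [e₁, hk.integral_meanSq_self hm, h4, h8, hk.diag 0, div_self (by positivity),
      add_sub_cancel_right]
    exact DIPE.average_self_le hD hN hM
  · rw [hk.integral_meanSq_prod hm, h4, h8]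
    exact DIPE.average_prod_le hD hN hM
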